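/- Let $\Omega=[0,2\pi]^2$ be the flat torus (opposite sides identified). Let $H=\{u\in L^2(\Omega)^2:\nabla\cdot u=0,\ \int_\Omega u=0\}$ with the $L^2$ norm, let $V=\{u\in H^1(\Omega)^2:\nabla\cdot u=0,\ \int_\Omega u=0\}$ with norm $\|u\|_V=\|\nabla u\|_{L^2}$, let $P:L^2(\Omega)^2\to H$ be the Helmholtz–Leray (orthogonal) projector, let $A=-P\Delta$ be the Stokes operator with domain $\mathcal D(A)=H^2(\Omega)^2\cap V$ (with norm $\|Au\|_{L^2}$), and let $B(u,v)=P[(u\cdot\nabla)v]$. Let $\nu>0$, $T>0$ and let $f\in V$ be a time-independent forcing. A strong solution on $[0,T]$ of the two-dimensional periodic Navier–Stokes equations with initial condition $u(0)\in V$ is a function $u\in C([0,T],V)\cap L^2((0,T],\mathcal D(A))$ with $du/dt\in L^2((0,T],H)$ such that $$\frac{du}{dt}+\nu Au+B(u,u)=f\quad\text{in } H,\ \text{for almost every } t\in(0,T].$$ **Theorem.** Let $u,v$ be strong solutions on $[0,T]$ (with the same $\nu$ and $f$) such that $\|u(0)\|_V+\|v(0)\|_V\le U<\infty$. A) There exists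 a constant $c_1$ depending only on $U,\nu,T,\|f\|_{L^2}$ such that $\sup_{0\le t\le T}\|u(t)-v(t)\|_{L^2}<c_1$ and $$\|u(0)-v(0)\|_{L^2}\le c_1\Big(\log\frac{c_1}{\|u(t)-v(t)\|_{L^2}}\Big)^{-1/2}\quad\text{for every } t\in[0,T],$$ where the right-hand side is read as $0$ if $u(t)=v(t)$ (so that then $u(0)=v(0)$). B) There exists a constant $c_2$ depending only on $U,\nu,T,\|f\|_{L^2}$ with the following property. If $0<c_P<\infty$ is such that $$\frac{\|u(0)-v(0)\|_V^2}{\|u(0)-v(0)\|_{L^2}^2}\le c_P$$ (a condition regarded as satisfied if $u(0)=v(0)$), then $$\|u(0)-v(0)\|_{L^2}\le e^{c_2c_P}\,\|u(t)-v(t)\|_{L^2}\quad\text{for every } t\in[0,T].$$ -/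

import Mathlib

open MeasureTheory Filter Topology Set
open scoped ContDiff

noncomputable section

namespace PeriodicNS

instance instTwoPiPos : Fact (0 < 2 * Real.pi) := ⟨Real.two_pi_pos⟩

/-- The flat torus `[0, 2π]²` with opposite sides identified; its `volume` is Lebesgue measure of
total mass `(2π)²`. -/
abbrev Torus : Type := Fin 2 → AddCircle (2 * Real.pi)

/-- The plane `ℝ²` with its Euclidean norm, in which the vector fields take values. -/
abbrev Plane : Type := EuclideanSpace ℝ (Fin 2)

/-- `L²(Ω)²`: square integrable vector fields on the torus, a real Hilbert space with
`⟪u, v⟫ = ∫ u · v dx`. -/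
abbrev L2Field : Type := Lp Plane 2 (volume : Measure Torus)

/-! ### Smooth functions and weak derivatives on the torus -/

/-- The covering map `ℝ² → Ω`. -/
def toTorus (y : Fin 2 → ℝ) : Torus := fun i => (y i : AddCircle (2 * Real.pi))

/-- `φ ∈ C^∞(Ω)`: the periodic function on `ℝ²` that corresponds to `φ` is infinitely
differentiable. -/
def SmoothOnTorus (φ : Torus → ℝ) : Prop := ContDiff ℝ ∞ (fun y : Fin 2 → ℝ => φ (toTorus y))

/-- The classical partial derivative `∂φ/∂x_j`. -/
def partialDeriv (j : Fin 2) (φ : Torus → ℝ) (x : Torus) : ℝ :=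
  deriv (fun s : ℝ => φ (x + Pi.single j (s : AddCircle (2 * Real.pi)))) 0

/-- `g` is the weak partial derivative `∂u/∂x_j` (componentwise) of the field `u`. -/
def HasWeakPartial (j : Fin 2) (u g : L2Field) : Prop :=
  ∀ φ : Torus → ℝ, SmoothOnTorus φ →
    ∫ x, partialDeriv j φ x • u x = - ∫ x, φ x • g x

/-- `u ∈ H^m(Ω)²`: all weak partial derivatives up to order `m` exist and lie in `L²`. -/
def MemSobolev : ℕ → L2Field → Prop
  | 0, _ => True
  | m + 1, u => ∀ j : Fin 2, ∃ g : L2Field, HasWeakPartial j u g ∧ MemSobolev m g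

open Classical in
/-- The weak partial derivative `∂u/∂x_j` as an element of `L²(Ω)²`. It is used only for fields for
which it exists (there it is unique); otherwise the value is `0`. -/
def weakPartial (j : Fin 2) (u : L2Field) : L2Field :=
  if h : ∃ g : L2Field, HasWeakPartial j u g then h.choose else 0

/-! ### The space `H` and the Leray projector -/

/-- `∇ · u = 0` in the sense of periodic distributions. -/
def DivFree (u : L2Field) : Prop :=
  ∀ φ : Torus → ℝ, SmoothOnTorus φ → ∫ x, ∑ i : Fin 2, u x i * partialDeriv i φ x = 0

theorem isOpenQuotientMap_toTorus : IsOpenQuotientMap toTorus :=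
  IsOpenQuotientMap.piMap (f := fun (_ : Fin 2) (y : ℝ) => (y : AddCircle (2 * Real.pi)))
    fun _ => QuotientAddGroup.isOpenQuotientMap_mk

theorem partialDeriv_toTorus (j : Fin 2) {φ : Torus → ℝ} (hφ : SmoothOnTorus φ)
    (y : Fin 2 → ℝ) : partialDeriv j φ (toTorus y) =
      fderiv ℝ (fun y : Fin 2 → ℝ => φ (toTorus y)) y (Pi.single j 1) := by
  have hd : DifferentiableAt ℝ (fun y : Fin 2 → ℝ => φ (toTorus y)) y :=
    (ContDiff.differentiable hφ (by simp)) y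
  rw [← hd.lineDeriv_eq_fderiv]
  unfold partialDeriv lineDeriv
  congr 1
  funext s
  congr 1
  funext i
  by_cases h : i = j
  · subst h; simp [toTorus]
  · simp [toTorus, h]

theorem continuous_partialDeriv (j : Fin 2) {φ : Torus → ℝ} (hφ : SmoothOnTorus φ) :
    Continuous (partialDeriv j φ) := by
  rw [isOpenQuotientMap_toTorus.isQuotientMap.continuous_iff]
  have : partialDeriv j φ ∘ toTorus =
      fun y => fderiv ℝ (fun y : Fin 2 → ℝ => φ (toTorus y)) y (Pi.single j 1) := by
    funext y
    exact partialDeriv_toTorus j hφ y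
  rw [this]
  exact (ContDiff.continuous_fderiv hφ (by simp)).clm_apply continuous_const

theorem memLp_gradient {φ : Torus → ℝ} (hφ : SmoothOnTorus φ) :
    MemLp (fun x => (WithLp.toLp 2 fun i => partialDeriv i φ x : Plane)) 2
      (volume : Measure Torus) := by
  have hc : Continuous (fun x => (WithLp.toLp 2 fun i => partialDeriv i φ x : Plane)) :=
    (PiLp.continuous_toLp 2 _).comp (continuous_pi fun i => continuous_partialDeriv i hφ)
  exact hc.memLp_of_hasCompactSupport (HasCompactSupport.of_compactSpace _)

theorem integral_mul_partialDeriv {φ : Torus → ℝ} (hφ : SmoothOnTorus φ) (u : L2Field) :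
    ∫ x, ∑ i : Fin 2, u x i * partialDeriv i φ x = inner ℝ (memLp_gradient hφ).toLp u := by
  rw [MeasureTheory.L2.inner_def]
  refine integral_congr_ae ?_
  filter_upwards [(memLp_gradient hφ).coeFn_toLp] with x hx
  rw [hx]
  simp [PiLp.inner_apply]

theorem integral_eq_zero_iff (u : L2Field) :
    ∫ x, u x = 0 ↔ ∀ c : Plane, inner ℝ (indicatorConstLp 2 (μ := (volume : Measure Torus))
      MeasurableSet.univ (measure_ne_top _ _) c) u = 0 := by
  simp only [MeasureTheory.L2.inner_indicatorConstLp_eq_inner_setIntegral, setIntegral_univ]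
  exact ⟨fun h c => by rw [h, inner_zero_right], fun h => inner_self_eq_zero.mp (h _)⟩

/-- `H = {u ∈ L²(Ω)² : ∇ · u = 0, ∫ u = 0}`. -/
def H : Submodule ℝ L2Field where
  carrier := {u | DivFree u ∧ ∫ x, u x = 0}
  add_mem' := by
    rintro u v ⟨hu, hu0⟩ ⟨hv, hv0⟩
    refine ⟨fun φ hφ => ?_, ?_⟩
    · have h1 := hu φ hφ
      have h2 := hv φ hφ
      rw [integral_mul_partialDeriv hφ] at h1 h2 ⊢
      rw [inner_add_right, h1, h2, add_zero]
    · rw [integral_eq_zero_iff] at hu0 hv0 ⊢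
      intro c
      rw [inner_add_right, hu0, hv0, add_zero]
  zero_mem' := by
    refine ⟨fun φ hφ => ?_, ?_⟩
    · rw [integral_mul_partialDeriv hφ, inner_zero_right]
    · rw [integral_eq_zero_iff]
      intro c
      rw [inner_zero_right]
  smul_mem' := by
    rintro a u ⟨hu, hu0⟩
    refine ⟨fun φ hφ => ?_, ?_⟩
    · have h1 := hu φ hφ
      rw [integral_mul_partialDeriv hφ] at h1 ⊢
      rw [inner_smul_right, h1, mul_zero]
    · rw [integral_eq_zero_iff] at hu0 ⊢
      intro c
      rw [inner_smul_right, hu0, mul_zero]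

theorem isClosed_H : IsClosed (H : Set L2Field) := by
  have : (H : Set L2Field) =
      (⋂ (φ : Torus → ℝ) (hφ : SmoothOnTorus φ),
        {u : L2Field | inner ℝ (memLp_gradient hφ).toLp u = (0 : ℝ)}) ∩
      ⋂ c : Plane, {u : L2Field | inner ℝ (indicatorConstLp 2 (μ := (volume : Measure Torus))
        MeasurableSet.univ (measure_ne_top _ _) c) u = (0 : ℝ)} := by
    ext u
    change (DivFree u ∧ ∫ x, u x = 0) ↔ _
    simp only [mem_inter_iff, mem_iInter, mem_ofPred_eq, integral_eq_zero_iff]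
    refine and_congr ⟨fun h φ hφ => ?_, fun h φ hφ => ?_⟩ Iff.rfl
    · rw [← integral_mul_partialDeriv hφ]
      exact h φ hφ
    · rw [integral_mul_partialDeriv hφ]
      exact h φ hφ
  rw [this]
  refine IsClosed.inter (isClosed_iInter fun φ => isClosed_iInter fun hφ => ?_)
    (isClosed_iInter fun c => ?_) <;>
  exact isClosed_eq (continuous_const.inner continuous_id) continuous_const

instance instHasOrthogonalProjectionH : H.HasOrthogonalProjection :=
  haveI : CompleteSpace H := isClosed_H.completeSpace_coe
  inferInstance

/-- The Helmholtz–Leray projector `P`: the orthogonal projection of `L²(Ω)²` onto `H`. -/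
def leray : L2Field →L[ℝ] L2Field := H.starProjection

/-! ### The space `V`, the Stokes operator, and strong solutions -/

/-- `V = {u ∈ H¹(Ω)² : ∇ · u = 0, ∫ u = 0}`. -/
def V : Set L2Field := {u | MemSobolev 1 u ∧ u ∈ H}

/-- `‖u‖_V = ‖∇u‖_{L²} = (∑_{i,j} ∫ |∂u_i/∂x_j|²)^{1/2}`. -/
def vNorm (u : L2Field) : ℝ := Real.sqrt (∑ j : Fin 2, ‖weakPartial j u‖ ^ 2)

/-- The domain of the Stokes operator, `D(A) = H²(Ω)² ∩ V`. -/
def stokesDomain : Set L2Field := {u | MemSobolev 2 u ∧ u ∈ V}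

/-- The Stokes operator `A u = -P Δ u` (meant for `u ∈ D(A)`). -/
def stokes (u : L2Field) : L2Field := - leray (∑ j : Fin 2, weakPartial j (weakPartial j u))

/-- The vector field `(u · ∇) v = ∑_j u_j ∂v/∂x_j`, defined almost everywhere. -/
def convection (u v : L2Field) (x : Torus) : Plane := ∑ j : Fin 2, u x j • weakPartial j v x

/-- `u` is a strong solution on `[0, T]` of the two-dimensional periodic Navier–Stokes equations
`du/dt + ν A u + B(u, u) = f`, where `B(u, u) = P[(u · ∇) u]`, with viscosity `ν` and time
independent forcing `f`; its initial condition is `u 0`. That is, `u ∈ C([0, T], V)`,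
`u ∈ L²((0, T], D(A))` where `D(A)` has the norm `‖A u‖_{L²}`, `u` has a time derivative `u'` in
`L²((0, T], H)`, and the equation holds in `H` for almost every `t`. -/
structure IsStrongSolution (ν T : ℝ) (f : L2Field) (u : ℝ → L2Field) : Prop where
  mem_V : ∀ t ∈ Icc 0 T, u t ∈ V
  continuous_V : ∀ t₀ ∈ Icc 0 T,
    Tendsto (fun t => vNorm (u t - u t₀)) (𝓝[Icc 0 T] t₀) (𝓝 0)
  mem_stokesDomain : ∀ᵐ t ∂(volume.restrict (Ioc 0 T)), u t ∈ stokesDomain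
  memLp_stokes : MemLp (fun t => stokes (u t)) 2 (volume.restrict (Ioc 0 T))
  evolution : ∃ u' : ℝ → L2Field,
    MemLp u' 2 (volume.restrict (Ioc 0 T)) ∧
    (∀ᵐ t ∂(volume.restrict (Ioc 0 T)), u' t ∈ H) ∧
    (∀ t ∈ Icc 0 T, u t = u 0 + ∫ s in (0 : ℝ)..t, u' s) ∧
    ∀ᵐ t ∂(volume.restrict (Ioc 0 T)), ∃ b : L2Field,
      (∀ᵐ x, b x = convection (u t) (u t) x) ∧
      u' t + ν • stokes (u t) + leray b = f

end PeriodicNS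

end

/-! Put w = u - v. Then w' = -ν A w - n with n = P[(u·∇)w + (w·∇)v], and the claim is that ‖w‖
cannot decay too fast. Up to the contribution of n, the logarithmic derivative of ‖w‖² is -2ν times
the Dirichlet quotient λ = ‖w‖_V² / ‖w‖², so it is enough to keep λ from growing.

In the derivative of λ the dissipation produces -2ν ‖A w - λ w‖² / ‖w‖². Completing the square
against n leaves λ' ≤ ‖n‖² / (2ν ‖w‖²) (`dirichlet_quotient_deriv_le`). Since ‖n‖ is at most a
constant times (‖A u‖ + ‖A v‖) ‖w‖_V (`norm_convection_sub_le`), this reads λ' ≤ k λ with k a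
multiple of ‖A u‖² + ‖A v‖². The integral of k is bounded by the data: in two dimensions (u·∇)u is
orthogonal to A u (`inner_convection_stokes`), so the enstrophy balance
(`IsStrongSolution.enstrophy_le`) controls the time integral of ‖A u‖². Hence λ(t) ≤ e^K λ(0), and
integrating the derivative of log ‖w‖² gives ‖w(0)‖² ≤ ‖w(t)‖² exp(G λ(0)), with G depending only on
the data (`dirichlet_quotient`). This is B. For A, take logarithms, multiply by ‖w(0)‖² and use λ(0)
‖w(0)‖² = ‖w(0)‖_V² ≤ 4U².

All spatial analysis is done on Fourier coefficients, where A is multiplication by |k|², products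
are convolutions and Sobolev embeddings are Cauchy–Schwarz inequalities. Time derivatives of the
quadratic energies are taken mode by mode and summed (`energy_identity`), which needs only scalar
absolutely continuous functions. -/

noncomputable section

namespace PeriodicNS

open Complex ComplexConjugate

/-! ### The Fourier basis of the torus -/

/-- The exponential `x ↦ exp(i k · x)` on the torus. -/
def expo (k : Fin 2 → ℤ) : C(Torus, ℂ) where
  toFun x := ∏ i, fourier (k i) (x i)
  continuous_toFun := by fun_prop

theorem expo_apply (k : Fin 2 → ℤ) (x : Torus) :
    expo k x = ∏ i, fourier (k i) (x i) := rfl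

theorem expo_neg (k : Fin 2 → ℤ) (x : Torus) : expo (-k) x = conj (expo k x) := by
  simp only [expo_apply, Pi.neg_apply, fourier_neg, map_prod]

theorem expo_add (j k : Fin 2 → ℤ) (x : Torus) : expo (j + k) x = expo j x * expo k x := by
  simp only [expo_apply, Pi.add_apply, fourier_add, ← Finset.prod_mul_distrib]

theorem expo_zero (x : Torus) : expo 0 x = 1 := by
  simp [expo_apply]

theorem norm_expo_apply (k : Fin 2 → ℤ) (x : Torus) : ‖expo k x‖ = 1 := by
  simp only [expo_apply, fourier_apply, norm_prod, Circle.norm_coe, Finset.prod_const_one]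

theorem expo_toTorus (k : Fin 2 → ℤ) (y : Fin 2 → ℝ) :
    expo k (toTorus y) = Complex.exp (I * ∑ i, (k i : ℂ) * (y i : ℂ)) := by
  have hpi : (Real.pi : ℂ) ≠ 0 := by exact_mod_cast Real.pi_ne_zero
  rw [expo_apply, Finset.mul_sum, Complex.exp_sum]
  refine Finset.prod_congr rfl fun i _ => ?_
  rw [toTorus, fourier_coe_apply]
  congr 1
  push_cast
  field_simp

theorem expo_single (z : Torus) (i : Fin 2) : expo (Pi.single i 1) z = fourier 1 (z i) := by
  fin_cases i <;> simp [expo_apply]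

/-- The star subalgebra of trigonometric polynomials. -/
def expoSubalgebra : StarSubalgebra ℂ C(Torus, ℂ) where
  toSubalgebra := Algebra.adjoin ℂ (range expo)
  star_mem' := by
    change Algebra.adjoin ℂ (range expo) ≤ star (Algebra.adjoin ℂ (range expo))
    refine Algebra.adjoin_le ?_
    rintro _ ⟨n, rfl⟩
    refine Algebra.subset_adjoin ⟨-n, ?_⟩
    ext1 x
    simp only [expo_neg, starRingEnd_apply, ContinuousMap.star_apply]

theorem expoSubalgebra_coe :
    expoSubalgebra.toSubalgebra.toSubmodule = Submodule.span ℂ (range expo) := by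
  apply Algebra.adjoin_eq_span_of_subset
  refine .trans (fun x ↦ Submonoid.closure_induction (fun _ ↦ id) ⟨0, ?_⟩ ?_)
    Submodule.subset_span
  · ext z
    exact expo_zero z
  · rintro _ _ _ _ ⟨m, rfl⟩ ⟨n, rfl⟩
    exact ⟨m + n, ContinuousMap.ext (expo_add m n)⟩

theorem expoSubalgebra_separatesPoints : expoSubalgebra.SeparatesPoints := by
  intro x y hxy
  rw [Ne, funext_iff, not_forall] at hxy
  obtain ⟨i, hi⟩ := hxy
  refine ⟨_, ⟨expo (Pi.single i 1), Algebra.subset_adjoin ⟨Pi.single i 1, rfl⟩, rfl⟩,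
    fun h => hi ?_⟩
  have h1 : expo (Pi.single i 1) x = expo (Pi.single i 1) y := h
  rw [expo_single, expo_single, fourier_one, fourier_one] at h1
  exact AddCircle.injective_toCircle Real.two_pi_pos.ne' (Subtype.ext h1)

/-- Stone–Weierstrass. Products of exponentials are exponentials, so their span is already the
generated algebra. -/
theorem span_expo_closure_eq_top :
    (Submodule.span ℂ (range expo)).topologicalClosure = ⊤ := by
  rw [← expoSubalgebra_coe]
  exact congr_arg (Subalgebra.toSubmodule <| StarSubalgebra.toSubalgebra ·)
    (ContinuousMap.starSubalgebra_topologicalClosure_eq_top_of_separatesPoints _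
    expoSubalgebra_separatesPoints)

/-- Complex valued square integrable functions on the torus. -/
abbrev L2C : Type := Lp ℂ 2 (volume : Measure Torus)

/-- The exponentials normalised in `L²`, as continuous functions. -/
def nexpo (k : Fin 2 → ℤ) : C(Torus, ℂ) := ((2 * Real.pi : ℝ) : ℂ)⁻¹ • expo k

theorem nexpo_apply (k : Fin 2 → ℤ) (x : Torus) :
    nexpo k x = ((2 * Real.pi : ℝ) : ℂ)⁻¹ * expo k x := rfl

/-- The exponentials normalised in `L²`. -/
def nexpoLp (k : Fin 2 → ℤ) : L2C := ContinuousMap.toLp (E := ℂ) 2 volume ℂ (nexpo k)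

theorem integral_fourier (n : ℤ) :
    ∫ x : AddCircle (2 * Real.pi), fourier n x = if n = 0 then ((2 * Real.pi : ℝ) : ℂ) else 0 := by
  have h := orthonormal_iff_ite.mp (orthonormal_fourier (T := 2 * Real.pi)) 0 n
  simp only [fourierLp, ContinuousMap.inner_toLp, ← fourier_neg, ← fourier_add] at h
  -- Orthonormality of `fourier` refers to the Haar probability measure, whereas `volume` has mass
  -- 2π.
  rw [AddCircle.volume_eq_smul_haarAddCircle, integral_smul_measure]
  simp only [neg_zero, add_zero] at h
  rw [h, ENNReal.toReal_ofReal Real.two_pi_pos.le]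
  by_cases hn : n = 0
  · simp [hn]
  · simp [hn, Ne.symm hn]

theorem integral_expo (k : Fin 2 → ℤ) :
    ∫ x, expo k x = if k = 0 then ((2 * Real.pi : ℝ) : ℂ) ^ 2 else 0 := by
  simp only [expo_apply]
  rw [MeasureTheory.integral_fintype_prod_volume_eq_prod (fun i => fourier (k i))]
  simp only [integral_fourier]
  by_cases hk : k = 0
  · simp [hk]
  · rw [if_neg hk]
    obtain ⟨i, hi⟩ := Function.ne_iff.mp hk
    exact Finset.prod_eq_zero (Finset.mem_univ i) (if_neg hi)

theorem orthonormal_nexpoLp : Orthonormal ℂ nexpoLp := by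
  rw [orthonormal_iff_ite]
  intro m n
  have hpi : ((2 * Real.pi : ℝ) : ℂ) ≠ 0 := by exact_mod_cast Real.two_pi_pos.ne'
  simp only [nexpoLp, ContinuousMap.inner_toLp, nexpo_apply, map_mul, map_inv₀, conj_ofReal]
  have : ∀ x : Torus, ((2 * Real.pi : ℝ) : ℂ)⁻¹ * expo n x *
      (((2 * Real.pi : ℝ) : ℂ)⁻¹ * conj (expo m x)) =
      (((2 * Real.pi : ℝ) : ℂ) ^ 2)⁻¹ * expo (n - m) x := by
    intro x
    rw [sub_eq_add_neg, expo_add, expo_neg]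
    field_simp
  simp only [this]
  rw [integral_const_mul, integral_expo]
  by_cases h : m = n
  · rw [if_pos (sub_eq_zero.mpr h.symm), if_pos h]
    field_simp
  · rw [if_neg (sub_ne_zero.mpr (Ne.symm h)), if_neg h, mul_zero]

theorem span_nexpoLp_closure_eq_top :
    (Submodule.span ℂ (range nexpoLp)).topologicalClosure = ⊤ := by
  have hpi : ((2 * Real.pi : ℝ) : ℂ) ≠ 0 := by exact_mod_cast Real.two_pi_pos.ne'
  have h : (Submodule.span ℂ (range nexpo)).topologicalClosure = ⊤ := by
    rw [eq_top_iff, ← span_expo_closure_eq_top]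
    refine Submodule.topologicalClosure_mono (Submodule.span_le.mpr ?_)
    rintro _ ⟨k, rfl⟩
    have : expo k = ((2 * Real.pi : ℝ) : ℂ) • nexpo k := by
      rw [nexpo, smul_smul, mul_inv_cancel₀ hpi, one_smul]
    rw [this]
    exact Submodule.smul_mem _ _ (Submodule.subset_span ⟨k, rfl⟩)
  have := (ContinuousMap.toLp_denseRange ℂ (volume : Measure Torus) ℂ
    (p := 2) (by simp)).topologicalClosure_map_submodule h
  rw [Submodule.map_span, ← range_comp] at this
  exact this

/-- The Fourier basis of `L²(Ω; ℂ)`. -/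
def fourierB : HilbertBasis (Fin 2 → ℤ) ℂ L2C :=
  HilbertBasis.mk orthonormal_nexpoLp span_nexpoLp_closure_eq_top.ge

theorem coe_fourierB : ⇑fourierB = nexpoLp := HilbertBasis.coe_mk _ _

/-- Fourier coefficients of a function in `L²(Ω; ℂ)`. -/
def fc (f : L2C) (k : Fin 2 → ℤ) : ℂ := fourierB.repr f k

theorem fc_eq_integral (f : L2C) (k : Fin 2 → ℤ) : fc f k = ∫ x, nexpo (-k) x * f x := by
  rw [fc, fourierB.repr_apply_apply, MeasureTheory.L2.inner_def, coe_fourierB]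
  refine integral_congr_ae ?_
  filter_upwards [ContinuousMap.coeFn_toLp (𝕜 := ℂ) (p := 2) volume (nexpo k)] with x hx
  rw [nexpoLp, hx, RCLike.inner_apply, nexpo_apply, nexpo_apply, map_mul, map_inv₀, expo_neg,
    conj_ofReal, mul_comm]

theorem hasSum_fc (f : L2C) : HasSum (fun k => fc f k • nexpoLp k) f := by
  rw [← coe_fourierB]
  exact fourierB.hasSum_repr f

theorem hasSum_norm_fc_sq (f : L2C) : HasSum (fun k => ‖fc f k‖ ^ 2) (‖f‖ ^ 2) := by
  have h := (fourierB.hasSum_inner_mul_inner f f).mapL Complex.reCLM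
  rw [inner_self_eq_norm_sq_to_K] at h
  convert h using 1
  · funext k
    simp only [fc, fourierB.repr_apply_apply, Complex.reCLM_apply]
    rw [← inner_conj_symm f, ← Complex.normSq_eq_conj_mul_self, Complex.normSq_eq_norm_sq,
      Complex.ofReal_re]
  · rw [Complex.reCLM_apply]
    norm_cast

theorem hasSum_inner_fc (f g : L2C) :
    HasSum (fun k => conj (fc f k) * fc g k) (inner ℂ f g) := by
  refine HasSum.congr_fun (fourierB.hasSum_inner_mul_inner f g) fun k => ?_
  rw [fc, fc, fourierB.repr_apply_apply, fourierB.repr_apply_apply, inner_conj_symm]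

theorem fc_sum {ι : Type*} (s : Finset ι) (f : ι → L2C) (k : Fin 2 → ℤ) :
    fc (∑ i ∈ s, f i) k = ∑ i ∈ s, fc (f i) k := by
  simp only [fc, fourierB.repr_apply_apply, inner_sum]

theorem norm_nexpo_apply_le (k : Fin 2 → ℤ) (x : Torus) : ‖nexpo k x‖ ≤ 1 := by
  rw [nexpo_apply, norm_mul, norm_expo_apply, mul_one, norm_inv, Complex.norm_real]
  refine inv_le_one_of_one_le₀ ?_
  rw [Real.norm_of_nonneg Real.two_pi_pos.le]
  linarith [Real.pi_gt_three]

/-- The Fourier series converges uniformly to a continuous function. Its class in L² must be f,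
because the series also converges to f there. -/
theorem hasSum_fc_ae {f : L2C} (hf : Summable fun k => ‖fc f k‖) :
    ∀ᵐ x, HasSum (fun k => fc f k * nexpo k x) (f x) := by
  have hs : Summable fun k => fc f k • nexpo k := by
    refine .of_norm_bounded hf fun k => ?_
    refine (ContinuousMap.norm_le _ (norm_nonneg _)).mpr fun x => ?_
    rw [ContinuousMap.smul_apply, norm_smul]
    exact mul_le_of_le_one_right (norm_nonneg _) (norm_nexpo_apply_le k x)
  obtain ⟨F, hF⟩ := hs
  have h1 := (hF.mapL (ContinuousMap.toLp (E := ℂ) 2 (volume : Measure Torus) ℂ))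
  simp only [map_smul] at h1
  have h2 := h1.unique (hasSum_fc f)
  have h3 := ContinuousMap.coeFn_toLp (𝕜 := ℂ) (p := 2) (volume : Measure Torus) F
  rw [h2] at h3
  filter_upwards [h3] with x hx
  rw [hx]
  exact hF.mapL (ContinuousMap.evalCLM ℂ x)

theorem norm_le_tsum_fc {f : L2C} (hf : Summable fun k => ‖fc f k‖) :
    ∀ᵐ x, ‖f x‖ ≤ ∑' k, ‖fc f k‖ := by
  filter_upwards [hasSum_fc_ae hf] with x hx
  rw [← hx.tsum_eq]
  refine tsum_of_norm_bounded hf.hasSum fun k => ?_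
  rw [norm_mul]
  exact mul_le_of_le_one_right (norm_nonneg _) (norm_nexpo_apply_le k x)

/-- The product of a function with absolutely summable Fourier coefficients and a square integrable
function is square integrable; its Fourier coefficients are given by convolution. -/
theorem exists_mul_fc {f : L2C} (hf : Summable fun k => ‖fc f k‖) (g : L2C) :
    ∃ p : L2C, (p =ᵐ[volume] fun x => f x * g x) ∧ ‖p‖ ≤ (∑' k, ‖fc f k‖) * ‖g‖ ∧
      ∀ m, HasSum (fun j => fc f j * fc g (m - j)) (((2 * Real.pi : ℝ) : ℂ) * fc p m) := by
  have hM : 0 ≤ ∑' k, ‖fc f k‖ := tsum_nonneg fun _ => norm_nonneg _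
  have hb : ∀ᵐ x, ‖f x * g x‖ ≤ (∑' k, ‖fc f k‖) * ‖g x‖ := by
    filter_upwards [norm_le_tsum_fc hf] with x hx
    rw [norm_mul]
    gcongr
  have hmem : MemLp (fun x => f x * g x) 2 (volume : Measure Torus) :=
    MemLp.of_le_mul (Lp.memLp g)
      ((Lp.aestronglyMeasurable f).mul (Lp.aestronglyMeasurable g)) hb
  refine ⟨hmem.toLp, hmem.coeFn_toLp, ?_, fun m => ?_⟩
  · refine Lp.norm_le_mul_norm_of_ae_le_mul ?_
    filter_upwards [hb, hmem.coeFn_toLp] with x hx hx'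
    rwa [hx']
  · have hpi : ((2 * Real.pi : ℝ) : ℂ) ≠ 0 := by exact_mod_cast Real.two_pi_pos.ne'
    have hgi : Integrable (g : Torus → ℂ) := (Lp.memLp g).integrable (by simp)
    have hint : ∀ j, Integrable fun x => nexpo (-m) x * (fc f j * nexpo j x * g x) := by
      intro j
      have h1 : ∀ x, nexpo (-m) x * (fc f j * nexpo j x * g x) =
          (nexpo (-m) x * fc f j * nexpo j x) * g x := fun x => by ring
      simp only [h1]
      refine hgi.bdd_mul (c := ‖fc f j‖) ?_ (ae_of_all _ fun x => ?_)
      · exact Continuous.aestronglyMeasurable (by fun_prop)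
      · rw [norm_mul, norm_mul]
        have h2 := norm_nexpo_apply_le (-m) x
        have h3 := norm_nexpo_apply_le j x
        calc ‖nexpo (-m) x‖ * ‖fc f j‖ * ‖nexpo j x‖ ≤ 1 * ‖fc f j‖ * 1 := by gcongr
          _ = _ := by ring
    have hle : ∀ j, ∫ x, ‖nexpo (-m) x * (fc f j * nexpo j x * g x)‖ ≤
        ‖fc f j‖ * ∫ x, ‖g x‖ := by
      intro j
      rw [← integral_const_mul]
      refine integral_mono (hint j).norm (hgi.norm.const_mul _) fun x => ?_
      simp only [norm_mul]
      have h2 := norm_nexpo_apply_le (-m) x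
      have h3 := norm_nexpo_apply_le j x
      calc ‖nexpo (-m) x‖ * (‖fc f j‖ * ‖nexpo j x‖ * ‖g x‖) ≤
          1 * (‖fc f j‖ * 1 * ‖g x‖) := by gcongr
        _ = _ := by ring
    -- Insert the series of f into the integral defining the coefficient of the product. Absolute
    -- summability permits termwise integration.
    have hsum := hasSum_integral_of_summable_integral_norm hint
      (Summable.of_nonneg_of_le (fun j => integral_nonneg fun x => norm_nonneg _) hle
        (hf.mul_right _))
    have hlim : ∫ x, ∑' j, nexpo (-m) x * (fc f j * nexpo j x * g x) = fc hmem.toLp m := by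
      rw [fc_eq_integral]
      refine integral_congr_ae ?_
      filter_upwards [hasSum_fc_ae hf, hmem.coeFn_toLp] with x hx hx'
      rw [hx', ((hx.mul_right (g x)).mul_left _).tsum_eq]
    rw [hlim] at hsum
    -- The product of two normalised exponentials is (2π)⁻¹ times a normalised one, hence the factor
    -- 2π.
    refine HasSum.congr_fun (hsum.mul_left ((2 * Real.pi : ℝ) : ℂ)) fun j => ?_
    rw [fc_eq_integral g, ← integral_const_mul, ← integral_const_mul]
    refine integral_congr_ae (ae_of_all _ fun x => ?_)
    simp only [nexpo_apply]
    rw [show -(m - j) = -m + j by abel, expo_add]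
    field_simp

/-! ### Fourier coefficients of vector fields -/

/-- The `i`-th component of a vector field, as a complex valued function. -/
def comp (i : Fin 2) : L2Field →L[ℝ] L2C :=
  (Complex.ofRealCLM ∘L (EuclideanSpace.proj i : Plane →L[ℝ] ℝ)).compLpL 2 volume

theorem comp_ae (i : Fin 2) (u : L2Field) : comp i u =ᵐ[volume] fun x => (u x i : ℂ) := by
  filter_upwards [ContinuousLinearMap.coeFn_compLpL (p := 2) (μ := (volume : Measure Torus))
    (Complex.ofRealCLM ∘L (EuclideanSpace.proj i : Plane →L[ℝ] ℝ)) u] with x hx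
  rw [comp, hx]
  simp

/-- The Fourier coefficient with index `k` of the `i`-th component of a vector field. -/
def coef (i : Fin 2) (k : Fin 2 → ℤ) : L2Field →L[ℝ] ℂ :=
  ((innerSL ℂ (nexpoLp k)).restrictScalars ℝ) ∘L comp i

theorem coef_apply (i : Fin 2) (k : Fin 2 → ℤ) (u : L2Field) :
    coef i k u = fc (comp i u) k := by
  rw [fc, fourierB.repr_apply_apply, coe_fourierB]
  rfl

theorem coef_eq_integral (i : Fin 2) (k : Fin 2 → ℤ) (u : L2Field) :
    coef i k u = ∫ x, nexpo (-k) x * (u x i : ℂ) := by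
  rw [coef_apply, fc_eq_integral]
  refine integral_congr_ae ?_
  filter_upwards [comp_ae i u] with x hx
  rw [hx]

theorem nexpo_neg (k : Fin 2 → ℤ) (x : Torus) : nexpo (-k) x = conj (nexpo k x) := by
  rw [nexpo_apply, nexpo_apply, map_mul, map_inv₀, expo_neg, conj_ofReal]

theorem coef_neg (i : Fin 2) (k : Fin 2 → ℤ) (u : L2Field) :
    coef i (-k) u = conj (coef i k u) := by
  rw [coef_eq_integral, coef_eq_integral, ← integral_conj]
  refine integral_congr_ae (ae_of_all _ fun x => ?_)
  simp only [map_mul, conj_ofReal, nexpo_neg, conj_conj]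

theorem inner_eq_sum_comp (u v : L2Field) :
    inner ℝ u v = ∑ i, (inner ℂ (comp i u) (comp i v)).re := by
  have h1 : ∀ i, (inner ℂ (comp i u) (comp i v)).re = ∫ x, u x i * v x i := by
    intro i
    rw [MeasureTheory.L2.inner_def]
    have := integral_re (𝕜 := ℂ) (L2.integrable_inner (𝕜 := ℂ) (comp i u) (comp i v))
    simp only [RCLike.re_to_complex] at this
    rw [← this]
    refine integral_congr_ae ?_
    filter_upwards [comp_ae i u, comp_ae i v] with x hx hy
    rw [hx, hy]
    simp [mul_comm]
  have h2 : ∀ i, Integrable fun x => u x i * v x i := by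
    intro i
    have := (L2.integrable_inner (𝕜 := ℂ) (comp i u) (comp i v)).re
    refine this.congr ?_
    filter_upwards [comp_ae i u, comp_ae i v] with x hx hy
    rw [hx, hy]
    simp [mul_comm]
  simp only [h1]
  rw [← integral_finsetSum _ fun i _ => h2 i, MeasureTheory.L2.inner_def]
  refine integral_congr_ae (ae_of_all _ fun x => ?_)
  simp [PiLp.inner_apply, mul_comm]

theorem hasSum_inner_coef (u v : L2Field) :
    HasSum (fun k => ∑ i, (conj (coef i k u) * coef i k v).re) (inner ℝ u v) := by
  rw [inner_eq_sum_comp]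
  refine hasSum_sum fun i _ => ?_
  simp only [coef_apply]
  exact (hasSum_inner_fc (comp i u) (comp i v)).mapL Complex.reCLM

/-- The energy of a vector field in the Fourier mode `k`. -/
def modeEnergy (u : L2Field) (k : Fin 2 → ℤ) : ℝ := ∑ i, ‖coef i k u‖ ^ 2

theorem modeEnergy_nonneg (u : L2Field) (k : Fin 2 → ℤ) : 0 ≤ modeEnergy u k :=
  Finset.sum_nonneg fun _ _ => sq_nonneg _

theorem norm_sq_eq_sum_comp (u : L2Field) : ‖u‖ ^ 2 = ∑ i, ‖comp i u‖ ^ 2 := by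
  rw [← real_inner_self_eq_norm_sq, inner_eq_sum_comp]
  refine Finset.sum_congr rfl fun i _ => ?_
  rw [inner_self_eq_norm_sq_to_K]
  norm_cast

theorem norm_le_sum_comp (u : L2Field) : ‖u‖ ≤ ∑ i, ‖comp i u‖ := by
  refine abs_le_of_sq_le_sq' ?_ (Finset.sum_nonneg fun _ _ => norm_nonneg _) |>.2
  rw [norm_sq_eq_sum_comp]
  exact Finset.sum_sq_le_sq_sum_of_nonneg fun _ _ => norm_nonneg _

theorem norm_comp_le (i : Fin 2) (u : L2Field) : ‖comp i u‖ ≤ ‖u‖ := by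
  refine abs_le_of_sq_le_sq' ?_ (norm_nonneg _) |>.2
  rw [norm_sq_eq_sum_comp]
  exact Finset.single_le_sum (f := fun i => ‖comp i u‖ ^ 2) (fun _ _ => sq_nonneg _)
    (Finset.mem_univ i)

theorem hasSum_modeEnergy (u : L2Field) : HasSum (modeEnergy u) (‖u‖ ^ 2) := by
  rw [norm_sq_eq_sum_comp]
  refine hasSum_sum fun i _ => ?_
  simp only [coef_apply]
  exact hasSum_norm_fc_sq (comp i u)

theorem ext_coef {u v : L2Field} (h : ∀ i k, coef i k u = coef i k v) : u = v := by
  have h1 := hasSum_modeEnergy (u - v)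
  have h2 : modeEnergy (u - v) = 0 := by
    funext k
    simp [modeEnergy, h]
  rw [h2] at h1
  have := h1.unique hasSum_zero
  rwa [sq_eq_zero_iff, norm_eq_zero, sub_eq_zero] at this

/-! ### Weak derivatives and Fourier coefficients -/

theorem surjective_toTorus : Function.Surjective toTorus :=
  isOpenQuotientMap_toTorus.surjective

theorem nexpo_add_single (k : Fin 2 → ℤ) (x : Torus) (j : Fin 2) (s : ℝ) :
    nexpo k (x + Pi.single j (s : AddCircle (2 * Real.pi))) =
      nexpo k x * Complex.exp (I * k j * s) := by
  obtain ⟨y, rfl⟩ := surjective_toTorus x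
  have : toTorus y + Pi.single j (s : AddCircle (2 * Real.pi)) =
      toTorus (y + Pi.single j s) := by
    funext i
    by_cases h : i = j
    · subst h; simp [toTorus]
    · simp [toTorus, h]
  rw [this, nexpo_apply, nexpo_apply, expo_toTorus, expo_toTorus, mul_assoc, ← Complex.exp_add]
  congr 2
  fin_cases j <;> simp [Fin.sum_univ_two] <;> ring

theorem hasDerivAt_nexpo (k : Fin 2 → ℤ) (x : Torus) (j : Fin 2) :
    HasDerivAt (fun s : ℝ => nexpo k (x + Pi.single j (s : AddCircle (2 * Real.pi))))
      (I * k j * nexpo k x) 0 := by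
  simp only [nexpo_add_single]
  have h : HasDerivAt (fun s : ℝ => I * k j * (s : ℂ)) (I * k j) 0 := by
    simpa using (Complex.ofRealCLM.hasDerivAt (x := (0 : ℝ))).const_mul (I * (k j : ℂ))
  refine (h.cexp.const_mul (nexpo k x)).congr_deriv ?_
  simp only [ofReal_zero, mul_zero, Complex.exp_zero, one_mul]
  ring

theorem partialDeriv_re_nexpo (k : Fin 2 → ℤ) (j : Fin 2) (x : Torus) :
    partialDeriv j (fun x => (nexpo k x).re) x = (I * k j * nexpo k x).re :=
  (Complex.reCLM.hasFDerivAt.comp_hasDerivAt (0 : ℝ) (hasDerivAt_nexpo k x j)).deriv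

theorem partialDeriv_im_nexpo (k : Fin 2 → ℤ) (j : Fin 2) (x : Torus) :
    partialDeriv j (fun x => (nexpo k x).im) x = (I * k j * nexpo k x).im :=
  (Complex.imCLM.hasFDerivAt.comp_hasDerivAt (0 : ℝ) (hasDerivAt_nexpo k x j)).deriv

theorem contDiff_nexpo (k : Fin 2 → ℤ) :
    ContDiff ℝ ∞ (fun y : Fin 2 → ℝ => nexpo k (toTorus y)) := by
  simp only [nexpo_apply, expo_toTorus]
  refine contDiff_const.mul (ContDiff.cexp (contDiff_const.mul (ContDiff.sum fun i _ => ?_)))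
  exact contDiff_const.mul (Complex.ofRealCLM.contDiff.comp (contDiff_apply ℝ ℝ i))

theorem smooth_re_nexpo (k : Fin 2 → ℤ) : SmoothOnTorus fun x => (nexpo k x).re :=
  Complex.reCLM.contDiff.comp (contDiff_nexpo k)

theorem smooth_im_nexpo (k : Fin 2 → ℤ) : SmoothOnTorus fun x => (nexpo k x).im :=
  Complex.imCLM.contDiff.comp (contDiff_nexpo k)

theorem SmoothOnTorus.continuous {φ : Torus → ℝ} (hφ : SmoothOnTorus φ) : Continuous φ := by
  rw [isOpenQuotientMap_toTorus.isQuotientMap.continuous_iff]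
  exact ContDiff.continuous hφ

theorem integrable_field (u : L2Field) : Integrable (u : Torus → Plane) :=
  (Lp.memLp u).integrable (by simp)

theorem integrable_field_apply (u : L2Field) (i : Fin 2) : Integrable fun x => u x i :=
  (EuclideanSpace.proj i : Plane →L[ℝ] ℝ).integrable_comp (integrable_field u)

theorem exists_norm_le_of_continuous {E : Type*} [NormedAddCommGroup E] {φ : Torus → E}
    (hφ : Continuous φ) : ∃ C, ∀ x, ‖φ x‖ ≤ C := by
  obtain ⟨C, hC⟩ := (isCompact_univ (X := Torus)).exists_bound_of_continuousOn hφ.continuousOn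
  exact ⟨C, fun x => hC x (mem_univ x)⟩

theorem integrable_smul_field {φ : Torus → ℝ} (hφ : Continuous φ) (u : L2Field) :
    Integrable fun x => φ x • u x := by
  obtain ⟨C, hC⟩ := exists_norm_le_of_continuous hφ
  exact (integrable_field u).bdd_smul C hφ.aestronglyMeasurable (ae_of_all _ hC)

theorem integrable_mul_field {φ : Torus → ℂ} (hφ : Continuous φ) (u : L2Field) (i : Fin 2) :
    Integrable fun x => φ x * (u x i : ℂ) := by
  obtain ⟨C, hC⟩ := exists_norm_le_of_continuous hφ
  exact (integrable_field_apply u i).ofReal.bdd_mul (c := C) hφ.aestronglyMeasurable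
    (ae_of_all _ hC)

theorem integral_smul_field_apply {φ : Torus → ℝ} (hφ : Continuous φ) (u : L2Field) (i : Fin 2) :
    (∫ x, φ x • u x) i = ∫ x, φ x * u x i :=
  ((EuclideanSpace.proj i : Plane →L[ℝ] ℝ).integral_comp_comm (integrable_smul_field hφ u)).symm

theorem integral_mul_field_eq {φ : Torus → ℂ} (hφ : Continuous φ) (u : L2Field) (i : Fin 2) :
    ∫ x, φ x * (u x i : ℂ) =
      ((∫ x, (φ x).re * u x i : ℝ) : ℂ) + ((∫ x, (φ x).im * u x i : ℝ) : ℂ) * I := by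
  have := integral_re_add_im (𝕜 := ℂ) (integrable_mul_field hφ u i)
  simp only [RCLike.re_to_complex, RCLike.im_to_complex, re_mul_ofReal, im_mul_ofReal] at this
  exact this.symm

/-- Test functions are real, so the definition is tested with the real and imaginary parts of the
exponential of index -k. The sign from integration by parts cancels the one from differentiating
that exponential. -/
theorem HasWeakPartial.coef_eq {j : Fin 2} {u g : L2Field} (h : HasWeakPartial j u g) (i : Fin 2)
    (k : Fin 2 → ℤ) : coef i k g = I * k j * coef i k u := by
  have hc : Continuous fun x : Torus => (nexpo (-k) x) := by fun_prop
  have hd : Continuous fun x : Torus => I * ((-k) j : ℤ) * nexpo (-k) x := by fun_prop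
  have key : ∀ φ : Torus → ℝ, SmoothOnTorus φ →
      ∫ x, partialDeriv j φ x * u x i = -∫ x, φ x * g x i := by
    intro φ hφ
    rw [← integral_smul_field_apply (continuous_partialDeriv j hφ), h φ hφ,
      ← integral_smul_field_apply hφ.continuous]
    rfl
  have h1 := key _ (smooth_re_nexpo (-k))
  have h2 := key _ (smooth_im_nexpo (-k))
  simp only [partialDeriv_re_nexpo, partialDeriv_im_nexpo] at h1 h2
  have h3 := integral_mul_field_eq hd u i
  rw [h1, h2] at h3
  have h4 := integral_mul_field_eq hc g i
  simp only [mul_assoc] at h3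
  rw [integral_const_mul, integral_const_mul, ← coef_eq_integral] at h3
  rw [← coef_eq_integral] at h4
  rw [h4]
  push_cast [Pi.neg_apply] at h3 ⊢
  linear_combination h3

theorem HasWeakPartial.unique {j : Fin 2} {u g g' : L2Field} (h : HasWeakPartial j u g)
    (h' : HasWeakPartial j u g') : g = g' :=
  ext_coef fun i k => by rw [h.coef_eq, h'.coef_eq]

theorem HasWeakPartial.weakPartial_eq {j : Fin 2} {u g : L2Field} (h : HasWeakPartial j u g) :
    weakPartial j u = g := by
  have he : ∃ g : L2Field, HasWeakPartial j u g := ⟨g, h⟩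
  rw [weakPartial, dif_pos he]
  exact he.choose_spec.unique h

theorem HasWeakPartial.sub {j : Fin 2} {u v g h : L2Field} (hu : HasWeakPartial j u g)
    (hv : HasWeakPartial j v h) : HasWeakPartial j (u - v) (g - h) := by
  intro φ hφ
  have aux : ∀ (ψ : Torus → ℝ), Continuous ψ → ∀ a b : L2Field,
      ∫ x, ψ x • (a - b : L2Field) x = (∫ x, ψ x • a x) - ∫ x, ψ x • b x := by
    intro ψ hψ a b
    rw [← integral_sub (integrable_smul_field hψ a) (integrable_smul_field hψ b)]
    refine integral_congr_ae ?_
    filter_upwards [Lp.coeFn_sub a b] with x hx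
    rw [hx, Pi.sub_apply, smul_sub]
  rw [aux _ (continuous_partialDeriv j hφ), aux _ hφ.continuous, hu φ hφ, hv φ hφ]
  abel

theorem DivFree.coef_eq {u : L2Field} (h : DivFree u) (k : Fin 2 → ℤ) :
    ∑ i, (k i : ℂ) * coef i k u = 0 := by
  have hd : ∀ i, Continuous fun x : Torus => I * ((-k) i : ℤ) * nexpo (-k) x := by fun_prop
  have key : ∀ φ : Torus → ℝ, SmoothOnTorus φ → ∑ i, ∫ x, partialDeriv i φ x * u x i = 0 := by
    intro φ hφ
    rw [← integral_finsetSum, ← h φ hφ]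
    · simp only [mul_comm]
    · intro i _
      exact (EuclideanSpace.proj i : Plane →L[ℝ] ℝ).integrable_comp
        (integrable_smul_field (continuous_partialDeriv i hφ) u)
  have h1 := key _ (smooth_re_nexpo (-k))
  have h2 := key _ (smooth_im_nexpo (-k))
  simp only [partialDeriv_re_nexpo, partialDeriv_im_nexpo] at h1 h2
  have h3 : ∑ i, ∫ x, I * ((-k) i : ℤ) * nexpo (-k) x * (u x i : ℂ) = 0 := by
    simp only [integral_mul_field_eq (hd _)]
    rw [Finset.sum_add_distrib, ← Finset.sum_mul, ← Complex.ofReal_sum, ← Complex.ofReal_sum,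
      h1, h2]
    simp
  simp only [mul_assoc, integral_const_mul, ← coef_eq_integral] at h3
  rw [← Finset.mul_sum] at h3
  have h4 := (mul_eq_zero.mp h3).resolve_left I_ne_zero
  rw [← neg_eq_zero, ← h4, ← Finset.sum_neg_distrib]
  refine Finset.sum_congr rfl fun i _ => ?_
  push_cast [Pi.neg_apply]
  ring

theorem coef_zero_of_mean_zero {u : L2Field} (h : ∫ x, u x = 0) (i : Fin 2) :
    coef i 0 u = 0 := by
  have h1 := integral_smul_field_apply (φ := fun _ => 1) continuous_const u i
  simp only [one_smul, one_mul, h] at h1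
  rw [coef_eq_integral]
  simp only [nexpo_apply, neg_zero, expo_zero]
  rw [integral_const_mul, integral_complex_ofReal, ← h1]
  simp

/-! ### Derivatives of divergence free fields -/

theorem SmoothOnTorus.partialDeriv {φ : Torus → ℝ} (hφ : SmoothOnTorus φ) (j : Fin 2) :
    SmoothOnTorus (partialDeriv j φ) := by
  have : (fun y : Fin 2 → ℝ => PeriodicNS.partialDeriv j φ (toTorus y)) =
      fun y => fderiv ℝ (fun y : Fin 2 → ℝ => φ (toTorus y)) y (Pi.single j 1) := by
    funext y
    exact partialDeriv_toTorus j hφ y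
  rw [SmoothOnTorus, this]
  exact (ContDiff.fderiv_right hφ (m := ∞) (by simp)).clm_apply contDiff_const

theorem partialDeriv_comm {φ : Torus → ℝ} (hφ : SmoothOnTorus φ) (i j : Fin 2) (x : Torus) :
    partialDeriv i (partialDeriv j φ) x = partialDeriv j (partialDeriv i φ) x := by
  obtain ⟨y, rfl⟩ := surjective_toTorus x
  have key : ∀ i j : Fin 2, partialDeriv i (partialDeriv j φ) (toTorus y) =
      fderiv ℝ (fderiv ℝ (fun y : Fin 2 → ℝ => φ (toTorus y))) y (Pi.single i 1)
        (Pi.single j 1) := by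
    intro i j
    rw [partialDeriv_toTorus i (hφ.partialDeriv j)]
    have : (fun y : Fin 2 → ℝ => PeriodicNS.partialDeriv j φ (toTorus y)) =
        fun y => fderiv ℝ (fun y : Fin 2 → ℝ => φ (toTorus y)) y (Pi.single j 1) := by
      funext y
      exact partialDeriv_toTorus j hφ y
    rw [this, fderiv_clm_apply]
    · simp
    · exact ((ContDiff.fderiv_right hφ (m := ∞) (by simp)).differentiable (by simp)) y
    · exact differentiableAt_const _
  rw [key, key]
  exact (ContDiff.contDiffAt hφ).isSymmSndFDerivAt
    (by simpa using (WithTop.coe_le_coe.mpr le_top :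
      ((2 : ℕ∞) : WithTop ℕ∞) ≤ ((⊤ : ℕ∞) : WithTop ℕ∞))) _ _

/-- Apply the weak derivative to the test functions ∂ᵢφ and the divergence condition to ∂ⱼφ. The
mixed partials agree. -/
theorem HasWeakPartial.divFree {j : Fin 2} {u g : L2Field} (h : HasWeakPartial j u g)
    (hu : DivFree u) : DivFree g := by
  intro φ hφ
  have hi : ∀ (v : L2Field) (i : Fin 2) (ψ : Torus → ℝ), SmoothOnTorus ψ →
      Integrable fun x => v x i * ψ x := by
    intro v i ψ hψ
    simp only [mul_comm _ (ψ _)]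
    exact (EuclideanSpace.proj i : Plane →L[ℝ] ℝ).integrable_comp
        (integrable_smul_field hψ.continuous v)
  have h1 := hu _ (hφ.partialDeriv j)
  rw [integral_finsetSum _ fun i _ => hi u i _ ((hφ.partialDeriv j).partialDeriv i)] at h1
  rw [integral_finsetSum _ fun i _ => hi g i _ (hφ.partialDeriv i), ← neg_eq_zero, ← h1,
    ← Finset.sum_neg_distrib]
  refine Finset.sum_congr rfl fun i _ => ?_
  have h2 := congrArg (fun z : Plane => z i) (h _ (hφ.partialDeriv i))
  simp only [PiLp.neg_apply] at h2
  rw [integral_smul_field_apply (continuous_partialDeriv j (hφ.partialDeriv i)),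
    integral_smul_field_apply (hφ.partialDeriv i).continuous] at h2
  simp only [mul_comm _ (PeriodicNS.partialDeriv _ _ _)]
  rw [← h2]
  simp only [partialDeriv_comm hφ i j]

theorem HasWeakPartial.integral_eq_zero {j : Fin 2} {u g : L2Field} (h : HasWeakPartial j u g) :
    ∫ x, g x = 0 := by
  have h1 := h (fun _ => 1) contDiff_const
  simpa [PeriodicNS.partialDeriv] using h1

theorem HasWeakPartial.mem_H {j : Fin 2} {u g : L2Field} (h : HasWeakPartial j u g)
    (hu : DivFree u) : g ∈ H := ⟨h.divFree hu, h.integral_eq_zero⟩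

/-- `|k|²`. -/
def freq (k : Fin 2 → ℤ) : ℝ := ∑ j, (k j : ℝ) ^ 2

theorem freq_nonneg (k : Fin 2 → ℤ) : 0 ≤ freq k := Finset.sum_nonneg fun _ _ => sq_nonneg _

theorem one_le_freq {k : Fin 2 → ℤ} (hk : k ≠ 0) : 1 ≤ freq k := by
  obtain ⟨i, hi⟩ := Function.ne_iff.mp hk
  have hi' : k i ≠ 0 := hi
  have h1 : (1 : ℝ) ≤ (k i : ℝ) ^ 2 := by
    have : 1 ≤ (k i) ^ 2 := by
      have : 0 < (k i) ^ 2 := by positivity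
      omega
    exact_mod_cast this
  exact h1.trans (Finset.single_le_sum (f := fun j => (k j : ℝ) ^ 2) (fun _ _ => sq_nonneg _)
    (Finset.mem_univ i))

theorem hasWeakPartial_of_mem_V {u : L2Field} (hu : u ∈ V) (j : Fin 2) :
    HasWeakPartial j u (weakPartial j u) := by
  obtain ⟨g, hg, -⟩ := hu.1 j
  rw [hg.weakPartial_eq]
  exact hg

theorem sub_mem_V {u v : L2Field} (hu : u ∈ V) (hv : v ∈ V) : u - v ∈ V := by
  refine ⟨fun j => ?_, H.sub_mem hu.2 hv.2⟩
  obtain ⟨g, hg, -⟩ := hu.1 j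
  obtain ⟨h, hh, -⟩ := hv.1 j
  exact ⟨g - h, hg.sub hh, trivial⟩

theorem weakPartial_sub {u v : L2Field} (hu : u ∈ V) (hv : v ∈ V) (j : Fin 2) :
    weakPartial j (u - v) = weakPartial j u - weakPartial j v :=
  ((hasWeakPartial_of_mem_V hu j).sub (hasWeakPartial_of_mem_V hv j)).weakPartial_eq

theorem vNorm_nonneg (u : L2Field) : 0 ≤ vNorm u := Real.sqrt_nonneg _

theorem vNorm_sq (u : L2Field) : vNorm u ^ 2 = ∑ j, ‖weakPartial j u‖ ^ 2 :=
  Real.sq_sqrt (Finset.sum_nonneg fun _ _ => sq_nonneg _)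

theorem norm_weakPartial_le (j : Fin 2) (u : L2Field) : ‖weakPartial j u‖ ≤ vNorm u := by
  refine abs_le_of_sq_le_sq' ?_ (vNorm_nonneg u) |>.2
  rw [vNorm_sq]
  exact Finset.single_le_sum (f := fun j => ‖weakPartial j u‖ ^ 2) (fun _ _ => sq_nonneg _)
    (Finset.mem_univ j)

theorem hasSum_vNorm {u : L2Field} (hu : u ∈ V) :
    HasSum (fun k => freq k * modeEnergy u k) (vNorm u ^ 2) := by
  rw [vNorm_sq]
  have : (fun k => freq k * modeEnergy u k) =
      fun k => ∑ j, modeEnergy (weakPartial j u) k := by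
    funext k
    simp only [modeEnergy, (hasWeakPartial_of_mem_V hu _).coef_eq, freq, Finset.sum_mul,
      norm_mul, mul_pow, Complex.norm_I, one_mul, Complex.norm_intCast, sq_abs,
      Finset.mul_sum]
    exact Finset.sum_comm
  rw [this]
  exact hasSum_sum fun j _ => hasSum_modeEnergy _

theorem coef_zero_of_mem_V {u : L2Field} (hu : u ∈ V) (i : Fin 2) : coef i 0 u = 0 :=
  coef_zero_of_mean_zero hu.2.2 i

theorem modeEnergy_le_freq_mul {u : L2Field} (hu : ∀ i, coef i 0 u = 0) (k : Fin 2 → ℤ) :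
    modeEnergy u k ≤ freq k * modeEnergy u k := by
  by_cases hk : k = 0
  · simp [hk, modeEnergy, hu]
  · exact le_mul_of_one_le_left (modeEnergy_nonneg u k) (one_le_freq hk)

/-- Poincaré's inequality, with constant 1 because every nonzero integer frequency has |k|² ≥ 1 and
the mean vanishes. -/
theorem norm_le_vNorm {u : L2Field} (hu : u ∈ V) : ‖u‖ ≤ vNorm u := by
  refine abs_le_of_sq_le_sq' ?_ (vNorm_nonneg u) |>.2
  exact hasSum_le (modeEnergy_le_freq_mul (coef_zero_of_mem_V hu)) (hasSum_modeEnergy u)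
    (hasSum_vNorm hu)

theorem hasWeakPartial_weakPartial {u : L2Field} (hu : u ∈ stokesDomain) (i j : Fin 2) :
    HasWeakPartial i (weakPartial j u) (weakPartial i (weakPartial j u)) := by
  obtain ⟨g, hg, hg'⟩ := hu.1 j
  obtain ⟨h, hh, -⟩ := hg' i
  rw [hg.weakPartial_eq, hh.weakPartial_eq]
  exact hh

/-- On the torus derivatives preserve zero divergence and have mean zero. Therefore P acts trivially
on Δu, and A is the Fourier multiplier |k|². -/
theorem laplacian_mem_H {u : L2Field} (hu : u ∈ stokesDomain) :
    ∑ j : Fin 2, weakPartial j (weakPartial j u) ∈ H :=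
  H.sum_mem fun j _ => (hasWeakPartial_weakPartial hu j j).mem_H
    ((hasWeakPartial_of_mem_V hu.2 j).divFree hu.2.2.1)

theorem leray_of_mem {u : L2Field} (hu : u ∈ H) : leray u = u :=
  Submodule.starProjection_eq_self_iff.mpr hu

theorem stokes_eq {u : L2Field} (hu : u ∈ stokesDomain) :
    stokes u = - ∑ j : Fin 2, weakPartial j (weakPartial j u) := by
  rw [stokes, leray_of_mem (laplacian_mem_H hu)]

theorem stokes_mem_H {u : L2Field} (hu : u ∈ stokesDomain) : stokes u ∈ H := by
  rw [stokes_eq hu]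
  exact H.neg_mem (laplacian_mem_H hu)

theorem coef_stokes {u : L2Field} (hu : u ∈ stokesDomain) (i : Fin 2) (k : Fin 2 → ℤ) :
    coef i k (stokes u) = freq k * coef i k u := by
  rw [stokes_eq hu]
  simp only [map_neg, map_sum, (hasWeakPartial_weakPartial hu _ _).coef_eq,
    (hasWeakPartial_of_mem_V hu.2 _).coef_eq, freq]
  push_cast
  rw [Finset.sum_mul, ← Finset.sum_neg_distrib]
  refine Finset.sum_congr rfl fun j _ => ?_
  linear_combination (-(k j : ℂ) ^ 2 * coef i k u) * I_sq

theorem norm_leray_le (u : L2Field) : ‖leray u‖ ≤ ‖u‖ :=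
  H.norm_starProjection_apply_le u

theorem inner_leray_of_mem {g : L2Field} (hg : g ∈ H) (b : L2Field) :
    inner ℝ (leray b) g = inner ℝ b g := by
  rw [leray, H.inner_starProjection_left_eq_right, H.starProjection_eq_self_iff.mpr hg]

/-! ### Summation lemmas -/

theorem summable_mul_of_sq {ι : Type*} {a b : ι → ℝ} (ha0 : ∀ i, 0 ≤ a i) (hb0 : ∀ i, 0 ≤ b i)
    (ha : Summable fun i => a i ^ 2) (hb : Summable fun i => b i ^ 2) :
    Summable fun i => a i * b i := by
  refine Summable.of_nonneg_of_le (fun i => mul_nonneg (ha0 i) (hb0 i)) (fun i => ?_) (ha.add hb)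
  nlinarith [sq_nonneg (a i - b i), mul_nonneg (ha0 i) (hb0 i)]

theorem sq_tsum_mul_le {ι : Type*} {a b : ι → ℝ} (ha0 : ∀ i, 0 ≤ a i) (hb0 : ∀ i, 0 ≤ b i)
    (ha : Summable fun i => a i ^ 2) (hb : Summable fun i => b i ^ 2) :
    (∑' i, a i * b i) ^ 2 ≤ (∑' i, a i ^ 2) * ∑' i, b i ^ 2 :=
  le_of_tendsto_of_tendsto' ((summable_mul_of_sq ha0 hb0 ha hb).hasSum.pow 2)
    (Tendsto.mul ha.hasSum hb.hasSum) fun s => Finset.sum_mul_sq_le_sq_mul_sq s a b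

theorem norm_sq_le_freq (k : Fin 2 → ℤ) : ‖k‖ ^ 2 ≤ freq k := by
  rw [← Real.le_sqrt (norm_nonneg _) (freq_nonneg k), pi_norm_le_iff_of_nonneg (Real.sqrt_nonneg _)]
  intro i
  refine Real.le_sqrt_of_sq_le ?_
  rw [Int.norm_eq_abs, sq_abs]
  exact Finset.single_le_sum (f := fun j => (k j : ℝ) ^ 2) (fun _ _ => sq_nonneg _)
    (Finset.mem_univ i)

/-- Comparison with the lattice sum of ‖k‖⁻⁴ in the sup norm, which converges because 4 > 2. -/
theorem summable_inv_freq_sq : Summable fun k => (freq k ^ 2)⁻¹ := by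
  refine Summable.of_nonneg_of_le (fun k => by positivity) (fun k => ?_)
    (EisensteinSeries.summable_one_div_norm_rpow (k := 4) (by norm_num))
  -- The term at k = 0 is 0⁻¹ = 0 by convention, so it does not count in the Sobolev constant.
  by_cases hk : k = 0
  · simp [hk, freq]
  · rw [Real.rpow_neg (norm_nonneg _)]
    have h0 : 0 < ‖k‖ := norm_pos_iff.mpr hk
    refine inv_anti₀ (Real.rpow_pos_of_pos h0 _) ?_
    have : ‖k‖ ^ (4 : ℝ) = (‖k‖ ^ 2) ^ 2 := by
      rw [← pow_mul, ← Real.rpow_natCast]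
      norm_num
    rw [this]
    exact pow_le_pow_left₀ (sq_nonneg _) (norm_sq_le_freq k) 2

/-- The Sobolev constant `∑_{k ≠ 0} |k|⁻⁴`. -/
def sobolevConst : ℝ := ∑' k : Fin 2 → ℤ, (freq k ^ 2)⁻¹

theorem sobolevConst_nonneg : 0 ≤ sobolevConst := tsum_nonneg fun k => by positivity

theorem freq_ne_zero {k : Fin 2 → ℤ} (hk : k ≠ 0) : freq k ≠ 0 :=
  (zero_lt_one.trans_le (one_le_freq hk)).ne'

/-- Cauchy–Schwarz for |k|⁻² times |k|² x(k). This is the embedding of H² into the functions with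
absolutely convergent Fourier series. -/
theorem summable_of_freq_sq {x : (Fin 2 → ℤ) → ℝ} (hx : ∀ k, 0 ≤ x k) (hx0 : x 0 = 0)
    (hs : Summable fun k => freq k ^ 2 * x k ^ 2) :
    Summable x ∧ ∑' k, x k ≤ √sobolevConst * √(∑' k, freq k ^ 2 * x k ^ 2) := by
  have e : ∀ k, x k = (freq k)⁻¹ * (freq k * x k) := by
    intro k
    by_cases hk : k = 0
    · simp [hk, hx0]
    · field_simp [freq_ne_zero hk]
  have h1 : ∀ k, 0 ≤ (freq k)⁻¹ := fun k => inv_nonneg.mpr (freq_nonneg k)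
  have h2 : ∀ k, 0 ≤ freq k * x k := fun k => mul_nonneg (freq_nonneg k) (hx k)
  have h3 := summable_inv_freq_sq
  simp only [← inv_pow] at h3
  simp only [← mul_pow] at hs ⊢
  have h4 := summable_mul_of_sq h1 h2 h3 hs
  have h5 := sq_tsum_mul_le h1 h2 h3 hs
  simp only [← e] at h4 h5
  refine ⟨h4, ?_⟩
  rw [← Real.sqrt_mul sobolevConst_nonneg]
  refine Real.le_sqrt_of_sq_le ?_
  simpa only [sobolevConst, ← inv_pow] using h5

/-- By ab ≤ (a² + b²)/2 and translation invariance, the sum of |j|⁻² |m - j|⁻² is bounded uniformly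
in m. It is the Cauchy–Schwarz weight for products of H¹ functions. -/
theorem summable_convolution_inv_freq (m : Fin 2 → ℤ) :
    (Summable fun j => ((√(freq j))⁻¹ * (√(freq (m - j)))⁻¹) ^ 2) ∧
      ∑' j, ((√(freq j))⁻¹ * (√(freq (m - j)))⁻¹) ^ 2 ≤ sobolevConst := by
  have h1 := summable_inv_freq_sq.hasSum
  have h2 : HasSum (fun j => (freq (m - j) ^ 2)⁻¹) sobolevConst :=
    (Equiv.subLeft m).hasSum_iff.mpr h1
  have h3 := (h1.add h2).mul_left (1 / 2 : ℝ)
  have hle : ∀ j, ((√(freq j))⁻¹ * (√(freq (m - j)))⁻¹) ^ 2 ≤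
      1 / 2 * ((freq j ^ 2)⁻¹ + (freq (m - j) ^ 2)⁻¹) := by
    intro j
    rw [mul_pow, inv_pow, inv_pow, Real.sq_sqrt (freq_nonneg _), Real.sq_sqrt (freq_nonneg _),
      ← inv_pow, ← inv_pow]
    nlinarith [sq_nonneg ((freq j)⁻¹ - (freq (m - j))⁻¹)]
  have hs := Summable.of_nonneg_of_le (fun j => sq_nonneg _) hle h3.summable
  refine ⟨hs, (hs.tsum_le_tsum hle h3.summable).trans_eq ?_⟩
  rw [h3.tsum_eq, sobolevConst]
  ring

/-- The change of variables `(m, j) ↦ (j, m - j)`. -/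
def convEquiv : (Fin 2 → ℤ) × (Fin 2 → ℤ) ≃ (Fin 2 → ℤ) × (Fin 2 → ℤ) where
  toFun z := (z.2, z.1 - z.2)
  invFun z := (z.1 + z.2, z.1)
  left_inv z := by simp
  right_inv z := by simp

/-- The product of two functions in `H¹` with mean zero is in `L²`. -/
theorem norm_sq_le_of_convolution {f g p : L2C} (hf0 : fc f 0 = 0) (hg0 : fc g 0 = 0)
    {X Y : ℝ} (hX : HasSum (fun k => freq k * ‖fc f k‖ ^ 2) X)
    (hY : HasSum (fun k => freq k * ‖fc g k‖ ^ 2) Y)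
    (hp : ∀ m, HasSum (fun j => fc f j * fc g (m - j)) (((2 * Real.pi : ℝ) : ℂ) * fc p m)) :
    ‖p‖ ^ 2 ≤ sobolevConst * (X * Y) := by
  have hXY : HasSum (fun z : (Fin 2 → ℤ) × (Fin 2 → ℤ) =>
      (freq z.1 * ‖fc f z.1‖ ^ 2) * (freq z.2 * ‖fc g z.2‖ ^ 2)) (X * Y) :=
    hX.mul hY (hX.summable.mul_of_nonneg hY.summable
      (fun k => mul_nonneg (freq_nonneg k) (sq_nonneg _))
      (fun k => mul_nonneg (freq_nonneg k) (sq_nonneg _)))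
  have hXY' := convEquiv.hasSum_iff.mpr hXY
  have hfib : ∀ m, Summable fun j =>
      (freq j * ‖fc f j‖ ^ 2) * (freq (m - j) * ‖fc g (m - j)‖ ^ 2) :=
    fun m => hXY'.summable.prod_factor m
  have hsum := hXY'.prod_fiberwise fun m => (hfib m).hasSum
  -- Cauchy–Schwarz in each convolution, with the weights |j| and |m - j|. Summing over m then
  -- factors the right side into X times Y.
  have hle : ∀ m, ‖fc p m‖ ^ 2 ≤ sobolevConst *
      ∑' j, (freq j * ‖fc f j‖ ^ 2) * (freq (m - j) * ‖fc g (m - j)‖ ^ 2) := by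
    intro m
    have e1 : ∀ j, (freq j * ‖fc f j‖ ^ 2) * (freq (m - j) * ‖fc g (m - j)‖ ^ 2) =
        (√(freq j) * ‖fc f j‖ * (√(freq (m - j)) * ‖fc g (m - j)‖)) ^ 2 := by
      intro j
      rw [mul_pow, mul_pow, mul_pow, Real.sq_sqrt (freq_nonneg _), Real.sq_sqrt (freq_nonneg _)]
    have e2 : ∀ j, ‖fc f j * fc g (m - j)‖ =
        (√(freq j) * ‖fc f j‖ * (√(freq (m - j)) * ‖fc g (m - j)‖)) *
          ((√(freq j))⁻¹ * (√(freq (m - j)))⁻¹) := by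
      intro j
      rw [norm_mul]
      by_cases h1 : j = 0
      · simp [h1, hf0]
      by_cases h2 : m - j = 0
      · simp [h2, hg0]
      have h3 : √(freq j) ≠ 0 := by
        rw [Real.sqrt_ne_zero']; exact zero_lt_one.trans_le (one_le_freq h1)
      have h4 : √(freq (m - j)) ≠ 0 := by
        rw [Real.sqrt_ne_zero']; exact zero_lt_one.trans_le (one_le_freq h2)
      field_simp
    obtain ⟨h5, h6⟩ := summable_convolution_inv_freq m
    have h7 := hfib m
    simp only [e1] at h7 ⊢
    have ha : ∀ j, 0 ≤ √(freq j) * ‖fc f j‖ * (√(freq (m - j)) * ‖fc g (m - j)‖) :=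
      fun j => by positivity
    have hb : ∀ j, 0 ≤ (√(freq j))⁻¹ * (√(freq (m - j)))⁻¹ := fun j => by positivity
    have h8 := summable_mul_of_sq ha hb h7 h5
    have h9 := sq_tsum_mul_le ha hb h7 h5
    simp only [← e2] at h8 h9
    have h10 : ‖((2 * Real.pi : ℝ) : ℂ) * fc p m‖ ≤ ∑' j, ‖fc f j * fc g (m - j)‖ := by
      rw [← (hp m).tsum_eq]
      exact norm_tsum_le_tsum_norm h8
    have h11 : ‖fc p m‖ ≤ ‖((2 * Real.pi : ℝ) : ℂ) * fc p m‖ := by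
      rw [norm_mul, Complex.norm_real, Real.norm_of_nonneg Real.two_pi_pos.le]
      exact le_mul_of_one_le_left (norm_nonneg _) (by linarith [Real.pi_gt_three])
    calc ‖fc p m‖ ^ 2 ≤ (∑' j, ‖fc f j * fc g (m - j)‖) ^ 2 :=
          pow_le_pow_left₀ (norm_nonneg _) (h11.trans h10) 2
      _ ≤ _ := h9
      _ ≤ _ := by
        rw [mul_comm sobolevConst]
        exact mul_le_mul_of_nonneg_left h6 (tsum_nonneg fun j => sq_nonneg _)
  exact hasSum_le hle (hasSum_norm_fc_sq p) (hsum.mul_left sobolevConst)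

/-! ### Estimates for the convection term -/

theorem modeEnergy_stokes {u : L2Field} (hu : u ∈ stokesDomain) (k : Fin 2 → ℤ) :
    modeEnergy (stokes u) k = freq k ^ 2 * modeEnergy u k := by
  simp only [modeEnergy, coef_stokes hu, norm_mul, mul_pow, Finset.mul_sum, Complex.norm_real,
    Real.norm_eq_abs, sq_abs]

theorem norm_coef_sq_le (u : L2Field) (i : Fin 2) (k : Fin 2 → ℤ) :
    ‖coef i k u‖ ^ 2 ≤ modeEnergy u k :=
  Finset.single_le_sum (f := fun i => ‖coef i k u‖ ^ 2) (fun _ _ => sq_nonneg _)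
    (Finset.mem_univ i)

theorem hasSum_stokes {u : L2Field} (hu : u ∈ stokesDomain) :
    HasSum (fun k => freq k ^ 2 * modeEnergy u k) (‖stokes u‖ ^ 2) := by
  exact (hasSum_modeEnergy (stokes u)).congr_fun fun k => (modeEnergy_stokes hu k).symm

theorem summable_norm_coef {u : L2Field} (hu : u ∈ stokesDomain) (i : Fin 2) :
    (Summable fun k => ‖fc (comp i u) k‖) ∧
      ∑' k, ‖fc (comp i u) k‖ ≤ √sobolevConst * ‖stokes u‖ := by
  simp only [← coef_apply]
  have hle : ∀ k, freq k ^ 2 * ‖coef i k u‖ ^ 2 ≤ freq k ^ 2 * modeEnergy u k := fun k =>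
    mul_le_mul_of_nonneg_left (norm_coef_sq_le u i k) (sq_nonneg _)
  have hs := Summable.of_nonneg_of_le (fun k => by positivity) hle (hasSum_stokes hu).summable
  obtain ⟨h1, h2⟩ := summable_of_freq_sq (x := fun k => ‖coef i k u‖) (fun k => norm_nonneg _)
    (by simp [coef_zero_of_mem_V hu.2]) hs
  refine ⟨h1, h2.trans (mul_le_mul_of_nonneg_left ?_ (Real.sqrt_nonneg _))⟩
  rw [Real.sqrt_le_left (norm_nonneg _)]
  exact hasSum_le hle hs.hasSum (hasSum_stokes hu)

theorem sq_le_freq (j : Fin 2) (k : Fin 2 → ℤ) : (k j : ℝ) ^ 2 ≤ freq k :=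
  Finset.single_le_sum (f := fun j => (k j : ℝ) ^ 2) (fun _ _ => sq_nonneg _) (Finset.mem_univ j)

/-- The difference of the convection terms is Lipschitz with respect to the norm of `V`. -/
theorem norm_convection_sub_le {u v b b' : L2Field} (hu : u ∈ stokesDomain)
    (hv : v ∈ stokesDomain) (hb : ∀ᵐ x, b x = convection u u x)
    (hb' : ∀ᵐ x, b' x = convection v v x) :
    ‖b - b'‖ ≤ 4 * √sobolevConst * (‖stokes u‖ + ‖stokes v‖) * vNorm (u - v) := by
  set w := u - v with hw
  have hwV : w ∈ V := sub_mem_V hu.2 hv.2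
  have hwS : ∀ j, Summable fun k => ‖fc (comp j w) k‖ := by
    intro j
    refine Summable.of_nonneg_of_le (fun k => norm_nonneg _) (fun k => ?_)
      ((summable_norm_coef hu j).1.add (summable_norm_coef hv j).1)
    simp only [← coef_apply]
    rw [hw, map_sub]
    exact norm_sub_le _ _
  choose p hp hpn hpc using fun i j =>
    exists_mul_fc (summable_norm_coef hu j).1 (comp i (weakPartial j w))
  -- The difference splits as (u·∇)w + (w·∇)v. Summability of the coefficients of w serves here only
  -- to justify the convolution formula. The quantitative bound on q must involve w through `vNorm`
  -- alone and comes from the H¹ product estimate.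
  choose q hq hqn hqc using fun i j => exists_mul_fc (hwS j) (comp i (weakPartial j v))
  have hcomp : ∀ i, comp i (b - b') = ∑ j, (p i j + q i j) := by
    intro i
    refine Lp.ext ?_
    have hpj := fun j => hp i j
    have hqj := fun j => hq i j
    filter_upwards [comp_ae i (b - b'), Lp.coeFn_sub b b', hb, hb', Lp.coeFn_sub u v,
      Lp.coeFn_add (p i 0 + q i 0) (p i 1 + q i 1), Lp.coeFn_add (p i 0) (q i 0),
      Lp.coeFn_add (p i 1) (q i 1), hpj 0, hpj 1, hqj 0, hqj 1, comp_ae 0 u, comp_ae 1 u,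
      comp_ae 0 w, comp_ae 1 w, comp_ae i (weakPartial 0 w), comp_ae i (weakPartial 1 w),
      comp_ae i (weakPartial 0 v), comp_ae i (weakPartial 1 v),
      Lp.coeFn_sub (weakPartial 0 u) (weakPartial 0 v),
      Lp.coeFn_sub (weakPartial 1 u) (weakPartial 1 v)] with
      x h1 h2 h3 h4 h5 h6 h7 h8 h9 h10 h11 h12 h13 h14 h15 h16 h17 h18 h19 h20 h21 h22
    rw [Fin.sum_univ_two, h6, Pi.add_apply, h7, h8, Pi.add_apply, Pi.add_apply, h9, h10, h11, h12,
      h13, h14, h15, h16, h17, h18, h19, h20, h1, h2, hw, h5, weakPartial_sub hu.2 hv.2,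
      weakPartial_sub hu.2 hv.2, h21, h22, Pi.sub_apply, h3, h4]
    simp only [convection, Fin.sum_univ_two, Pi.sub_apply, PiLp.sub_apply, PiLp.add_apply,
      PiLp.smul_apply, smul_eq_mul]
    push_cast
    ring
  have hpb : ∀ i j, ‖p i j‖ ≤ √sobolevConst * ‖stokes u‖ * vNorm w := by
    intro i j
    refine (hpn i j).trans (mul_le_mul (summable_norm_coef hu j).2 ?_ (norm_nonneg _) ?_)
    · exact (norm_comp_le _ _).trans (norm_weakPartial_le j w)
    · exact mul_nonneg (Real.sqrt_nonneg _) (norm_nonneg _)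
  have hqb : ∀ i j, ‖q i j‖ ≤ √sobolevConst * ‖stokes v‖ * vNorm w := by
    intro i j
    have hX0 := hasSum_vNorm hwV
    have hY0 := hasSum_stokes hv
    have hXle : ∀ k, freq k * ‖fc (comp j w) k‖ ^ 2 ≤ freq k * modeEnergy w k := by
      intro k
      rw [← coef_apply]
      exact mul_le_mul_of_nonneg_left (norm_coef_sq_le w j k) (freq_nonneg k)
    have hYle : ∀ k, freq k * ‖fc (comp i (weakPartial j v)) k‖ ^ 2 ≤
        freq k ^ 2 * modeEnergy v k := by
      intro k
      rw [← coef_apply, (hasWeakPartial_of_mem_V hv.2 j).coef_eq, norm_mul, norm_mul,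
        Complex.norm_I, one_mul, mul_pow, Complex.norm_intCast, sq_abs, sq (freq k), mul_assoc]
      exact mul_le_mul_of_nonneg_left (mul_le_mul (sq_le_freq j k) (norm_coef_sq_le v i k)
        (sq_nonneg _) (freq_nonneg k)) (freq_nonneg k)
    have hX := Summable.of_nonneg_of_le
      (fun k => mul_nonneg (freq_nonneg k) (sq_nonneg _)) hXle hX0.summable
    have hY := Summable.of_nonneg_of_le
      (fun k => mul_nonneg (freq_nonneg k) (sq_nonneg _)) hYle hY0.summable
    have h := norm_sq_le_of_convolution (f := comp j w) (g := comp i (weakPartial j v))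
      (by rw [← coef_apply, coef_zero_of_mem_V hwV])
      (by rw [← coef_apply, (hasWeakPartial_of_mem_V hv.2 j).coef_eq, coef_zero_of_mem_V hv.2,
        mul_zero]) hX.hasSum hY.hasSum (hqc i j)
    refine abs_le_of_sq_le_sq' ?_ (mul_nonneg (mul_nonneg (Real.sqrt_nonneg _) (norm_nonneg _))
      (vNorm_nonneg _)) |>.2
    rw [mul_pow, mul_pow, Real.sq_sqrt sobolevConst_nonneg]
    refine h.trans ?_
    rw [mul_assoc, mul_comm (‖stokes v‖ ^ 2)]
    refine mul_le_mul_of_nonneg_left ?_ sobolevConst_nonneg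
    exact mul_le_mul (hasSum_le hXle hX.hasSum hX0) (hasSum_le hYle hY.hasSum hY0)
      (tsum_nonneg fun k => mul_nonneg (freq_nonneg k) (sq_nonneg _)) (sq_nonneg _)
  -- The factor 4 counts the pairs (i, j).
  calc ‖b - b'‖ ≤ ∑ i, ‖comp i (b - b')‖ := norm_le_sum_comp _
    _ ≤ ∑ i : Fin 2, ∑ j : Fin 2, (√sobolevConst * ‖stokes u‖ * vNorm w +
        √sobolevConst * ‖stokes v‖ * vNorm w) := by
      refine Finset.sum_le_sum fun i _ => ?_
      rw [hcomp]
      refine (norm_sum_le _ _).trans (Finset.sum_le_sum fun j _ => ?_)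
      exact (norm_add_le _ _).trans (add_le_add (hpb i j) (hqb i j))
    _ = _ := by
      simp only [Finset.sum_const, Finset.card_univ, Fintype.card_fin, nsmul_eq_mul]
      push_cast
      ring

/-! ### The cancellation in the enstrophy equation -/

/-- The change of variables `(p, q) ↦ (p, -p - q)`. -/
def triadEquiv : (Fin 2 → ℤ) × (Fin 2 → ℤ) ≃ (Fin 2 → ℤ) × (Fin 2 → ℤ) where
  toFun z := (z.1, -z.1 - z.2)
  invFun z := (z.1, -z.1 - z.2)
  left_inv z := by simp
  right_inv z := by simp

/-- Bound yz by y² + z²; each resulting double series is a product of convergent series after a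
change of variables. For u in D(A) it applies to û in ℓ¹, |q|û and |r|²û in ℓ², so triad sums may be
rearranged. -/
theorem summable_triad {x y z : (Fin 2 → ℤ) → ℝ} (hx0 : ∀ k, 0 ≤ x k) (hy0 : ∀ k, 0 ≤ y k)
    (hz0 : ∀ k, 0 ≤ z k) (hx : Summable x) (hy : Summable fun k => y k ^ 2)
    (hz : Summable fun k => z k ^ 2) :
    Summable fun s : (Fin 2 → ℤ) × (Fin 2 → ℤ) => x s.1 * (y s.2 * z (-s.1 - s.2)) := by
  have h1 := hx.mul_of_nonneg hy hx0 fun k => sq_nonneg _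
  have h2 := triadEquiv.summable_iff.mpr (hx.mul_of_nonneg hz hx0 fun k => sq_nonneg _)
  refine Summable.of_nonneg_of_le
    (fun s => mul_nonneg (hx0 _) (mul_nonneg (hy0 _) (hz0 _))) (fun s => ?_) (h1.add h2)
  simp only [triadEquiv, Function.comp_apply, Equiv.coe_fn_mk]
  rw [← mul_add]
  refine mul_le_mul_of_nonneg_left ?_ (hx0 _)
  nlinarith [sq_nonneg (y s.2 - z (-s.1 - s.2)), mul_nonneg (hy0 s.2) (hz0 (-s.1 - s.2))]

/-- The density of the trilinear form `∫ (u · ∇) u · Δ u` on triads of Fourier modes. -/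
def triadTerm (u : L2Field) (p q r : Fin 2 → ℤ) : ℂ :=
  ∑ i, ∑ l, coef l p u * ((q l : ℂ) * coef i q u) * ((freq r : ℂ) * coef i r u)

/-- In the plane k · û(k) = 0 forces û(k) to be a multiple of the rotated vector k. At k = 0 both
sides vanish. -/
theorem exists_streamFunction {u : L2Field} (hu : u ∈ V) :
    ∃ ψ : (Fin 2 → ℤ) → ℂ, ∀ k, coef 0 k u = -(k 1) * ψ k ∧ coef 1 k u = k 0 * ψ k := by
  refine ⟨fun k => (k 0 * coef 1 k u - k 1 * coef 0 k u) / freq k, fun k => ?_⟩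
  by_cases hk : k = 0
  · simp [hk, coef_zero_of_mem_V hu]
  · have h1 : (freq k : ℂ) ≠ 0 := by exact_mod_cast freq_ne_zero hk
    have h2 := hu.2.1.coef_eq k
    rw [Fin.sum_univ_two] at h2
    have h3 : (freq k : ℂ) = (k 0 : ℂ) ^ 2 + (k 1 : ℂ) ^ 2 := by
      rw [freq, Fin.sum_univ_two]; push_cast; ring
    constructor
    · field_simp
      rw [h3]
      linear_combination (k 0 : ℂ) * h2
    · field_simp
      rw [h3]
      linear_combination (k 1 : ℂ) * h2

/-- In terms of the stream function a triad term is (p × q)(q · r)|r|² ψ(p)ψ(q)ψ(r). When p + q + r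
= 0 the cross products p × q, q × r and r × p coincide, and 2 q · r = |p|² - |q|² - |r|² and its
analogues make the six permutations cancel. -/
theorem triadTerm_symm {u : L2Field} (hu : u ∈ V) (p q r : Fin 2 → ℤ) (h : r = -p - q) :
    triadTerm u p q r + triadTerm u q p r + triadTerm u p r q + triadTerm u r p q +
      triadTerm u q r p + triadTerm u r q p = 0 := by
  obtain ⟨ψ, hψ⟩ := exists_streamFunction hu
  have h3 : ∀ k, (freq k : ℂ) = (k 0 : ℂ) ^ 2 + (k 1 : ℂ) ^ 2 := by
    intro k
    rw [freq, Fin.sum_univ_two]; push_cast; ring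
  have h0 : (r 0 : ℂ) = -(p 0) - q 0 := by rw [h]; simp
  have h1 : (r 1 : ℂ) = -(p 1) - q 1 := by rw [h]; simp
  simp only [triadTerm, Fin.sum_univ_two, (hψ _).1, (hψ _).2, h3, h0, h1]
  ring

theorem summable_triadTerm {u : L2Field} (hu : u ∈ stokesDomain) :
    Summable fun s : (Fin 2 → ℤ) × (Fin 2 → ℤ) => triadTerm u s.1 s.2 (-s.1 - s.2) := by
  refine summable_sum fun i _ => summable_sum fun l _ => ?_
  have hx := (summable_norm_coef hu l).1
  simp only [← coef_apply] at hx
  have hz : Summable fun k => (freq k * ‖coef i k u‖) ^ 2 := by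
    refine Summable.of_nonneg_of_le (fun k => sq_nonneg _) (fun k => ?_)
      (hasSum_stokes hu).summable
    rw [mul_pow]
    exact mul_le_mul_of_nonneg_left (norm_coef_sq_le u i k) (sq_nonneg _)
  have hy : Summable fun k => (|(k l : ℝ)| * ‖coef i k u‖) ^ 2 := by
    refine Summable.of_nonneg_of_le (fun k => sq_nonneg _) (fun k => ?_)
      (hasSum_vNorm hu.2).summable
    rw [mul_pow, sq_abs]
    exact mul_le_mul (sq_le_freq l k) (norm_coef_sq_le u i k) (sq_nonneg _) (freq_nonneg k)
  refine Summable.of_norm_bounded (summable_triad (fun k => norm_nonneg _)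
    (fun k => by positivity) (fun k => mul_nonneg (freq_nonneg k) (norm_nonneg _)) hx hy hz)
    fun s => le_of_eq ?_
  simp only [norm_mul, Complex.norm_intCast, Complex.norm_real, Real.norm_eq_abs,
    abs_of_nonneg (freq_nonneg _)]
  ring

/-- Permuting (p, q, r) acts bijectively on the triads with p + q + r = 0. All six rearranged series
therefore have the same sum X, and 6X = 0. -/
theorem hasSum_zero_of_perm_sum_zero {τ : (Fin 2 → ℤ) → (Fin 2 → ℤ) → (Fin 2 → ℤ) → ℂ}
    (hτ : Summable fun s : (Fin 2 → ℤ) × (Fin 2 → ℤ) => τ s.1 s.2 (-s.1 - s.2))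
    (h0 : ∀ p q r, r = -p - q →
      τ p q r + τ q p r + τ p r q + τ r p q + τ q r p + τ r q p = 0) :
    HasSum (fun s : (Fin 2 → ℤ) × (Fin 2 → ℤ) => τ s.1 s.2 (-s.1 - s.2)) 0 := by
  obtain ⟨X, hX⟩ := hτ
  have hswap : ∀ {g : (Fin 2 → ℤ) × (Fin 2 → ℤ) → ℂ}, HasSum g X →
      HasSum (fun s : (Fin 2 → ℤ) × (Fin 2 → ℤ) => g (s.2, s.1)) X :=
    fun hg => (Equiv.prodComm _ _).hasSum_iff.mpr hg
  have htri : ∀ {g : (Fin 2 → ℤ) × (Fin 2 → ℤ) → ℂ}, HasSum g X →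
      HasSum (fun s : (Fin 2 → ℤ) × (Fin 2 → ℤ) => g (s.1, -s.1 - s.2)) X :=
    fun hg => triadEquiv.hasSum_iff.mpr hg
  have h2 := hswap hX
  have h3 := htri hX
  have h4 := htri h2
  have h5 := hswap h3
  have h6 := hswap h4
  have hsum := ((((hX.add h2).add h3).add h4).add h5).add h6
  have hX6 : X + X + X + X + X + X = 0 := by
    refine hsum.unique (HasSum.congr_fun hasSum_zero fun s => ?_)
    have e1 : -s.2 - s.1 = -s.1 - s.2 := by abel
    have e2 : -s.1 - (-s.1 - s.2) = s.2 := by abel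
    have e3 : -(-s.1 - s.2) - s.1 = s.2 := by abel
    have e4 : -s.2 - (-s.1 - s.2) = s.1 := by abel
    have e5 : -(-s.1 - s.2) - s.2 = s.1 := by abel
    simp only [e1, e2, e3, e4, e5]
    exact h0 s.1 s.2 _ rfl
  have : X = 0 := by linear_combination hX6 / 6
  rwa [this] at hX

theorem hasSum_triadTerm {u : L2Field} (hu : u ∈ stokesDomain) :
    HasSum (fun s : (Fin 2 → ℤ) × (Fin 2 → ℤ) => triadTerm u s.1 s.2 (-s.1 - s.2)) 0 :=
  hasSum_zero_of_perm_sum_zero (summable_triadTerm hu) (triadTerm_symm hu.2)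

/-- In two dimensions the convection term `(u · ∇) u` is orthogonal to `A u`. -/
theorem inner_convection_stokes {u b : L2Field} (hu : u ∈ stokesDomain)
    (hb : ∀ᵐ x, b x = convection u u x) : inner ℝ b (stokes u) = 0 := by
  choose p hp hpn hpc using fun i j =>
    exists_mul_fc (summable_norm_coef hu j).1 (comp i (weakPartial j u))
  have hcomp : ∀ i, comp i b = ∑ j, p i j := by
    intro i
    refine Lp.ext ?_
    have hpj := fun j => hp i j
    filter_upwards [comp_ae i b, hb, Lp.coeFn_add (p i 0) (p i 1), hpj 0, hpj 1, comp_ae 0 u,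
      comp_ae 1 u, comp_ae i (weakPartial 0 u), comp_ae i (weakPartial 1 u)] with
      x h1 h2 h3 h4 h5 h6 h7 h8 h9
    rw [Fin.sum_univ_two, h3, Pi.add_apply, h4, h5, h6, h7, h8, h9, h1, h2]
    simp only [convection, Fin.sum_univ_two, PiLp.add_apply, PiLp.smul_apply, smul_eq_mul]
    push_cast
    ring
  have hpi : ((2 * Real.pi : ℝ) : ℂ) ≠ 0 := by exact_mod_cast Real.two_pi_pos.ne'
  have hconv : ∀ i m, HasSum (fun j => ∑ l, coef l j u * (I * ((m - j) l : ℤ) * coef i (m - j) u))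
      (((2 * Real.pi : ℝ) : ℂ) * coef i m b) := by
    intro i m
    rw [coef_apply, hcomp, fc_sum, Finset.mul_sum]
    refine hasSum_sum fun l _ => ?_
    have := hpc i l m
    simpa only [← coef_apply, (hasWeakPartial_of_mem_V hu.2 l).coef_eq] using this
  -- Since u is real, conjugation turns the mode m of A u into the mode -m, which closes the triad
  -- (j, m - j, -m). The factor -I cancels the I of the derivative.
  have hfib : ∀ m, HasSum (fun j => triadTerm u j (m - j) (-m))
      (-I * ((2 * Real.pi : ℝ) : ℂ) * ∑ i, coef i m b * conj (coef i m (stokes u))) := by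
    intro m
    rw [Finset.mul_sum]
    refine hasSum_sum fun i _ => ?_
    have h1 := (hconv i m).mul_left (-I * ((freq (-m) : ℂ) * coef i (-m) u))
    have h2 : freq (-m) = freq m := by simp [freq]
    have h3 : -I * ((2 * Real.pi : ℝ) : ℂ) * (coef i m b * conj (coef i m (stokes u))) =
        -I * ((freq (-m) : ℂ) * coef i (-m) u) * (((2 * Real.pi : ℝ) : ℂ) * coef i m b) := by
      rw [coef_stokes hu, map_mul, conj_ofReal, coef_neg, h2]
      ring
    rw [h3]
    refine h1.congr_fun fun j => ?_
    rw [Finset.mul_sum]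
    refine Finset.sum_congr rfl fun l _ => ?_
    linear_combination (coef l j u * ((m - j) l : ℤ) * coef i (m - j) u *
      ((freq (-m) : ℂ) * coef i (-m) u)) * I_sq
  have h1 := convEquiv.hasSum_iff.mpr (hasSum_triadTerm hu)
  have h2 : HasSum (fun m => -I * ((2 * Real.pi : ℝ) : ℂ) *
      ∑ i, coef i m b * conj (coef i m (stokes u))) 0 := by
    refine h1.prod_fiberwise fun m => ?_
    convert hfib m using 2 with j
    simp only [convEquiv, Function.comp_apply, Equiv.coe_fn_mk]
    congr 1
    abel
  have h3 := (h2.mul_left (I / ((2 * Real.pi : ℝ) : ℂ))).mapL Complex.reCLM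
  refine (hasSum_inner_coef b (stokes u)).unique ?_
  rw [mul_zero, map_zero] at h3
  convert h3 using 2 with m
  have h4 : I / ((2 * Real.pi : ℝ) : ℂ) * (-I * ((2 * Real.pi : ℝ) : ℂ) *
      ∑ i, coef i m b * conj (coef i m (stokes u))) =
      ∑ i, coef i m b * conj (coef i m (stokes u)) := by
    field_simp
    rw [I_sq]
    ring
  rw [h4, Complex.reCLM_apply, Complex.re_sum]
  refine Finset.sum_congr rfl fun i _ => ?_
  simp [Complex.mul_re]

/-! ### Primitives of integrable functions of time -/

theorem ae_hasDerivAt_primitive {f : ℝ → ℝ} {s : ℝ} (hs : 0 ≤ s)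
    (hf : IntervalIntegrable f volume 0 s) (a : ℝ) :
    ∀ᵐ t, t ∈ Icc 0 s → HasDerivAt (fun t => a + ∫ r in (0 : ℝ)..t, f r) (f t) t := by
  filter_upwards [hf.ae_hasDerivAt_integral] with t ht hts
  rw [uIcc_of_le hs] at ht
  exact (ht hts 0 (left_mem_Icc.mpr hs)).const_add a

theorem absolutelyContinuous_primitive {f : ℝ → ℝ} {s : ℝ}
    (hf : IntervalIntegrable f volume 0 s) (a : ℝ) :
    AbsolutelyContinuousOnInterval (fun t => a + ∫ r in (0 : ℝ)..t, f r) 0 s := by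
  have h1 : AbsolutelyContinuousOnInterval (fun _ : ℝ => a) 0 s :=
    ((LipschitzWith.const a).lipschitzOnWith (s := uIcc 0 s)).absolutelyContinuousOnInterval
  exact h1.fun_add (hf.absolutelyContinuousOnInterval_intervalIntegral left_mem_uIcc)

/-- Product rule for absolutely continuous functions. It is applied to the primitive of f, which
agrees with F on [0, T]. -/
theorem sq_primitive {f F : ℝ → ℝ} {T t : ℝ} (hf : IntervalIntegrable f volume 0 T)
    (hF : ∀ t ∈ Icc 0 T, F t = F 0 + ∫ r in (0 : ℝ)..t, f r) (ht : t ∈ Icc 0 T) :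
    IntervalIntegrable (fun r => 2 * (F r * f r)) volume 0 t ∧
      F t ^ 2 = F 0 ^ 2 + ∫ r in (0 : ℝ)..t, 2 * (F r * f r) := by
  have hsub : ∀ r ∈ Icc 0 t, r ∈ Icc 0 T := fun r hr => ⟨hr.1, hr.2.trans ht.2⟩
  have hf' : IntervalIntegrable f volume 0 t := hf.mono_set (by
    rw [uIcc_of_le ht.1, uIcc_of_le (ht.1.trans ht.2)]
    exact hsub)
  have hG := absolutelyContinuous_primitive hf' (F 0)
  have hcont : ContinuousOn F (uIcc 0 t) := by
    refine hG.continuousOn.congr fun r hr => ?_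
    rw [uIcc_of_le ht.1] at hr
    exact hF r (hsub r hr)
  refine ⟨((hf'.continuousOn_mul hcont).const_mul 2), ?_⟩
  have h1 := hG.integral_deriv_mul_eq_sub hG
  rw [← hF t ht, ← hF 0 (hsub 0 (left_mem_Icc.mpr ht.1))] at h1
  have h2 : ∫ r in (0 : ℝ)..t, 2 * (F r * f r) = F t * F t - F 0 * F 0 := by
    rw [← h1]
    refine intervalIntegral.integral_congr_ae ?_
    filter_upwards [ae_hasDerivAt_primitive ht.1 hf' (F 0)] with r hr hrt
    rw [uIoc_of_le ht.1] at hrt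
    have hrt' : r ∈ Icc 0 t := ⟨hrt.1.le, hrt.2⟩
    rw [(hr hrt').deriv, ← hF r (hsub r hrt')]
    ring
  rw [h2]
  ring

theorem normSq_primitive {c c' : ℝ → ℂ} {T t : ℝ} (hc' : IntervalIntegrable c' volume 0 T)
    (hc : ∀ t ∈ Icc 0 T, c t = c 0 + ∫ r in (0 : ℝ)..t, c' r) (ht : t ∈ Icc 0 T) :
    IntervalIntegrable (fun r => 2 * (conj (c r) * c' r).re) volume 0 t ∧
      ‖c t‖ ^ 2 = ‖c 0‖ ^ 2 + ∫ r in (0 : ℝ)..t, 2 * (conj (c r) * c' r).re := by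
  have hsub : ∀ t ∈ Icc 0 T, IntervalIntegrable c' volume 0 t := fun t ht => hc'.mono_set (by
    rw [uIcc_of_le ht.1, uIcc_of_le (ht.1.trans ht.2)]
    exact fun r hr => ⟨hr.1, hr.2.trans ht.2⟩)
  have hre : IntervalIntegrable (fun r => (c' r).re) volume 0 T :=
    ⟨Complex.reCLM.integrable_comp hc'.1, Complex.reCLM.integrable_comp hc'.2⟩
  have him : IntervalIntegrable (fun r => (c' r).im) volume 0 T :=
    ⟨Complex.imCLM.integrable_comp hc'.1, Complex.imCLM.integrable_comp hc'.2⟩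
  obtain ⟨i1, e1⟩ := sq_primitive (F := fun t => (c t).re) hre (fun t ht => by
    have h := Complex.reCLM.intervalIntegral_comp_comm (hsub t ht)
    simp only [Complex.reCLM_apply] at h
    rw [h, hc t ht, Complex.add_re]) ht
  obtain ⟨i2, e2⟩ := sq_primitive (F := fun t => (c t).im) him (fun t ht => by
    have h := Complex.imCLM.intervalIntegral_comp_comm (hsub t ht)
    simp only [Complex.imCLM_apply] at h
    rw [h, hc t ht, Complex.add_im]) ht
  have e3 : ∀ r, 2 * (conj (c r) * c' r).re =
      2 * ((c r).re * (c' r).re) + 2 * ((c r).im * (c' r).im) := by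
    intro r
    simp only [Complex.mul_re, Complex.conj_re, Complex.conj_im]
    ring
  simp only [e3]
  refine ⟨i1.add i2, ?_⟩
  rw [intervalIntegral.integral_add i1 i2]
  have e4 : ∀ z : ℂ, ‖z‖ ^ 2 = z.re ^ 2 + z.im ^ 2 := fun z => by
    rw [← Complex.normSq_eq_norm_sq, Complex.normSq_apply]; ring
  rw [e4, e4, e1, e2]
  ring

/-! ### Energy identities -/

theorem integrable_inner_of_memLp {X : Type*} [MeasurableSpace X] {μ : Measure X} {E : Type*}
    [NormedAddCommGroup E] [InnerProductSpace ℝ E] {f g : X → E} (hf : MemLp f 2 μ)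
    (hg : MemLp g 2 μ) : Integrable (fun x => inner ℝ (f x) (g x)) μ := by
  refine Integrable.mono' ((hf.integrable_norm_pow (by simp)).add (hg.integrable_norm_pow (by simp)))
    (hf.1.inner hg.1) (ae_of_all _ fun x => ?_)
  have := norm_inner_le_norm (𝕜 := ℝ) (f x) (g x)
  refine this.trans ?_
  simp only [Pi.add_apply]
  nlinarith [sq_nonneg (‖f x‖ - ‖g x‖), norm_nonneg (f x), norm_nonneg (g x)]

/-- A Fourier coefficient is a continuous linear functional and commutes with the time integral, so
only the scalar product rule is needed. -/
theorem modeEnergy_primitive {T t : ℝ} {w w' : ℝ → L2Field}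
    (hw' : IntervalIntegrable w' volume 0 T)
    (hw : ∀ t ∈ Icc 0 T, w t = w 0 + ∫ s in (0 : ℝ)..t, w' s) (ht : t ∈ Icc 0 T)
    (k : Fin 2 → ℤ) :
    modeEnergy (w t) k = modeEnergy (w 0) k +
      ∫ s in (0 : ℝ)..t, ∑ i, 2 * (conj (coef i k (w s)) * coef i k (w' s)).re := by
  have h := fun i => normSq_primitive (c := fun t => coef i k (w t))
    (c' := fun t => coef i k (w' t)) (T := T) (t := t)
    ⟨(coef i k).integrable_comp hw'.1, (coef i k).integrable_comp hw'.2⟩ (fun t ht => by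
      rw [hw t ht, map_add, (coef i k).intervalIntegral_comp_comm]
      refine hw'.mono_set ?_
      rw [uIcc_of_le ht.1, uIcc_of_le (ht.1.trans ht.2)]
      exact fun r hr => ⟨hr.1, hr.2.trans ht.2⟩) ht
  rw [intervalIntegral.integral_finsetSum fun i _ => (h i).1]
  simp only [modeEnergy]
  rw [← Finset.sum_add_distrib]
  exact Finset.sum_congr rfl fun i _ => (h i).2

/-- The energy identity for a quadratic form that is diagonal in the Fourier basis. -/
theorem energy_identity {T : ℝ} (hT : 0 ≤ T) {w w' g : ℝ → L2Field} {m : (Fin 2 → ℤ) → ℝ}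
    {E : ℝ → ℝ} (hw' : MemLp w' 2 (volume.restrict (Ioc 0 T)))
    (hg : MemLp g 2 (volume.restrict (Ioc 0 T)))
    (hw : ∀ t ∈ Icc 0 T, w t = w 0 + ∫ s in (0 : ℝ)..t, w' s)
    (hcoef : ∀ᵐ t ∂(volume.restrict (Ioc 0 T)), ∀ i k, coef i k (g t) = m k * coef i k (w t))
    (hE : ∀ t ∈ Icc 0 T, HasSum (fun k => m k * modeEnergy (w t) k) (E t)) :
    IntervalIntegrable (fun t => 2 * inner ℝ (g t) (w' t)) volume 0 T ∧
      ∀ t ∈ Icc 0 T, E t = E 0 + ∫ s in (0 : ℝ)..t, 2 * inner ℝ (g s) (w' s) := by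
  have hint := integrable_inner_of_memLp hg hw'
  refine ⟨(intervalIntegrable_iff_integrableOn_Ioc_of_le hT).mpr (hint.const_mul 2),
    fun t ht => ?_⟩
  have hwi : IntervalIntegrable w' volume 0 T :=
    (intervalIntegrable_iff_integrableOn_Ioc_of_le hT).mpr (hw'.integrable (by simp))
  have hres : volume.restrict (uIoc 0 t) ≤ volume.restrict (Ioc 0 T) := by
    rw [uIoc_of_le ht.1]
    exact Measure.restrict_mono_set _ (Ioc_subset_Ioc_right ht.2)
  have hsum : HasSum (fun k => ∫ s in (0 : ℝ)..t,
      ∑ i, 2 * (conj (coef i k (g s)) * coef i k (w' s)).re)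
      (∫ s in (0 : ℝ)..t, 2 * inner ℝ (g s) (w' s)) := by
    -- Dominating series: 2|ab| ≤ |a|² + |b|² in each mode, with total ‖g‖² + ‖w'‖², integrable in
    -- time.
    have hb : ∀ s, HasSum (fun k => modeEnergy (g s) k + modeEnergy (w' s) k)
        (‖g s‖ ^ 2 + ‖w' s‖ ^ 2) := fun s => (hasSum_modeEnergy _).add (hasSum_modeEnergy _)
    refine intervalIntegral.hasSum_integral_of_dominated_convergence
      (fun k s => modeEnergy (g s) k + modeEnergy (w' s) k) (fun k => ?_) (fun k => ?_) ?_ ?_ ?_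
    · have h1 : ∀ i, AEStronglyMeasurable (fun s => coef i k (g s)) (volume.restrict (uIoc 0 t)) :=
        fun i => (coef i k).continuous.comp_aestronglyMeasurable (hg.1.mono_measure hres)
      have h2 : ∀ i, AEStronglyMeasurable (fun s => coef i k (w' s)) (volume.restrict (uIoc 0 t)) :=
        fun i => (coef i k).continuous.comp_aestronglyMeasurable (hw'.1.mono_measure hres)
      refine Finset.aestronglyMeasurable_fun_sum _ fun i _ => ?_
      exact (Complex.continuous_re.comp_aestronglyMeasurable
        ((Complex.continuous_conj.comp_aestronglyMeasurable (h1 i)).mul (h2 i))).const_mul 2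
    · refine ae_of_all _ fun s _ => ?_
      simp only [modeEnergy]
      rw [← Finset.sum_add_distrib]
      refine (norm_sum_le _ _).trans (Finset.sum_le_sum fun i _ => ?_)
      have h1 := Complex.abs_re_le_norm (conj (coef i k (g s)) * coef i k (w' s))
      rw [norm_mul, Complex.norm_conj] at h1
      rw [Real.norm_eq_abs, abs_mul, abs_two]
      nlinarith [sq_nonneg (‖coef i k (g s)‖ - ‖coef i k (w' s)‖)]
    · exact ae_of_all _ fun s _ => (hb s).summable
    · simp only [(hb _).tsum_eq]
      rw [intervalIntegrable_iff]
      exact ((hg.integrable_norm_pow (by simp)).add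
        (hw'.integrable_norm_pow (by simp))).mono_measure hres
    · refine ae_of_all _ fun s _ => ?_
      simp only [← Finset.mul_sum]
      exact (hasSum_inner_coef (g s) (w' s)).mul_left 2
  have h0 := hE 0 (left_mem_Icc.mpr hT)
  refine (hE t ht).unique ((h0.add hsum).congr_fun fun k => ?_)
  rw [modeEnergy_primitive hwi hw ht k, mul_add, ← intervalIntegral.integral_const_mul]
  congr 1
  refine intervalIntegral.integral_congr_ae ?_
  have h1 : ∀ᵐ t ∂(volume.restrict (uIoc 0 t)), ∀ i k, coef i k (g t) = m k * coef i k (w t) :=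
    ae_mono hres hcoef
  rw [ae_restrict_iff' measurableSet_uIoc] at h1
  filter_upwards [h1] with s hs hst
  rw [Finset.mul_sum]
  refine Finset.sum_congr rfl fun i _ => ?_
  rw [hs hst i k, map_mul, conj_ofReal, mul_assoc, Complex.re_ofReal_mul]
  ring

/-! ### The Dirichlet quotient -/

theorem absolutelyContinuous_lipschitz_comp {f φ : ℝ → ℝ} {a b : ℝ} {K : NNReal}
    {S : Set ℝ} (hφ : LipschitzOnWith K φ S) (hf : AbsolutelyContinuousOnInterval f a b)
    (hS : MapsTo f (uIcc a b) S) : AbsolutelyContinuousOnInterval (fun t => φ (f t)) a b := by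
  rw [absolutelyContinuousOnInterval_iff] at hf ⊢
  intro ε hε
  obtain ⟨δ, hδ, h⟩ := hf (ε / (K + 1)) (by positivity)
  refine ⟨δ, hδ, fun P hP hlen => ?_⟩
  have h1 := h P hP hlen
  have h2 : ∑ i ∈ Finset.range P.1, dist (φ (f (P.2 i).1)) (φ (f (P.2 i).2)) ≤
      K * ∑ i ∈ Finset.range P.1, dist (f (P.2 i).1) (f (P.2 i).2) := by
    rw [Finset.mul_sum]
    refine Finset.sum_le_sum fun i hi => ?_
    exact hφ.dist_le_mul _ (hS (hP.1 i hi).1) _ (hS (hP.1 i hi).2)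
  refine h2.trans_lt ?_
  rw [lt_div_iff₀ (by positivity)] at h1
  have h3 : 0 ≤ ∑ i ∈ Finset.range P.1, dist (f (P.2 i).1) (f (P.2 i).2) :=
    Finset.sum_nonneg fun _ _ => dist_nonneg
  nlinarith

/-- By compactness f has a positive minimum, above which the logarithm is Lipschitz. -/
theorem absolutelyContinuous_log {f : ℝ → ℝ} {s : ℝ} (hs : 0 ≤ s)
    (hf : AbsolutelyContinuousOnInterval f 0 s) (hpos : ∀ t ∈ Icc 0 s, 0 < f t) :
    AbsolutelyContinuousOnInterval (fun t => Real.log (f t)) 0 s := by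
  have hc := hf.continuousOn
  rw [uIcc_of_le hs] at hc
  obtain ⟨t₀, ht₀, hmin⟩ := isCompact_Icc.exists_isMinOn (nonempty_Icc.mpr hs) hc
  have hδ := hpos t₀ ht₀
  have hl : LipschitzOnWith (Real.toNNReal (f t₀)⁻¹) Real.log (Ici (f t₀)) := by
    refine Convex.lipschitzOnWith_of_nnnorm_deriv_le (fun x hx => ?_) (fun x hx => ?_)
      (convex_Ici _)
    · exact Real.differentiableAt_log (hδ.trans_le hx).ne'
    · rw [Real.deriv_log, ← NNReal.coe_le_coe, coe_nnnorm, Real.coe_toNNReal _ (by positivity),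
        norm_inv, Real.norm_of_nonneg (hδ.trans_le hx).le]
      exact inv_anti₀ hδ hx
  refine absolutelyContinuous_lipschitz_comp hl hf fun t ht => ?_
  rw [uIcc_of_le hs] at ht
  exact hmin ht

theorem sub_le_integral_of_deriv_le {f f' g : ℝ → ℝ} {s : ℝ} (hs : 0 ≤ s)
    (hf : AbsolutelyContinuousOnInterval f 0 s)
    (hd : ∀ᵐ t, t ∈ Icc 0 s → HasDerivAt f (f' t) t) (hg : IntervalIntegrable g volume 0 s)
    (hle : ∀ᵐ t ∂(volume.restrict (Ioc 0 s)), f' t ≤ g t) :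
    f s - f 0 ≤ ∫ t in (0 : ℝ)..s, g t := by
  rw [← hf.integral_deriv_eq_sub]
  refine intervalIntegral.integral_mono_ae_restrict hs hf.intervalIntegrable_deriv hg ?_
  rw [EventuallyLE, ← restrict_Ioc_eq_restrict_Icc, ae_restrict_iff' measurableSet_Ioc]
  rw [ae_restrict_iff' measurableSet_Ioc] at hle
  filter_upwards [hd, hle] with t h1 h2 ht
  rw [(h1 ⟨ht.1.le, ht.2⟩).deriv]
  exact h2 ht

/-- Control of the Dirichlet quotient `E / L` and the resulting lower bound for `L`, as long as
`L` does not vanish. -/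
theorem dirichlet_quotient_of_pos {L E l e k : ℝ → ℝ} {s c K : ℝ} (hs : 0 ≤ s) (hc : 0 ≤ c)
    (hl : IntervalIntegrable l volume 0 s) (he : IntervalIntegrable e volume 0 s)
    (hk : IntervalIntegrable k volume 0 s)
    (hL : ∀ t ∈ Icc 0 s, L t = L 0 + ∫ r in (0 : ℝ)..t, l r)
    (hE : ∀ t ∈ Icc 0 s, E t = E 0 + ∫ r in (0 : ℝ)..t, e r)
    (hpos : ∀ t ∈ Icc 0 s, 0 < L t) (hLE : ∀ t ∈ Icc 0 s, L t ≤ E t) (hk0 : ∀ t, 0 ≤ k t)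
    (hK : ∀ t ∈ Icc 0 s, ∫ r in (0 : ℝ)..t, k r ≤ K)
    (h1 : ∀ᵐ t ∂(volume.restrict (Ioc 0 s)), e t * L t - E t * l t ≤ k t * E t * L t)
    (h2 : ∀ᵐ t ∂(volume.restrict (Ioc 0 s)), -l t ≤ (c + k t) * E t) :
    L 0 ≤ L s * Real.exp ((c * s + K) * (Real.exp K * (E 0 / L 0))) := by
  have hs0 : (0 : ℝ) ∈ Icc 0 s := left_mem_Icc.mpr hs
  have hss : s ∈ Icc 0 s := right_mem_Icc.mpr hs
  have hEpos : ∀ t ∈ Icc 0 s, 0 < E t := fun t ht => (hpos t ht).trans_le (hLE t ht)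
  have hsub : ∀ {f : ℝ → ℝ}, IntervalIntegrable f volume 0 s → ∀ t ∈ Icc 0 s,
      IntervalIntegrable f volume 0 t := fun hf t ht => hf.mono_set (by
    rw [uIcc_of_le ht.1, uIcc_of_le hs]
    exact Icc_subset_Icc_right ht.2)
  set G := fun t => L 0 + ∫ r in (0 : ℝ)..t, l r with hG
  set D := fun t => E 0 + ∫ r in (0 : ℝ)..t, e r with hD
  have hlogL : AbsolutelyContinuousOnInterval (fun t => Real.log (G t)) 0 s :=
    absolutelyContinuous_log hs (absolutelyContinuous_primitive hl _) fun t ht => by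
      simpa only [hG, ← hL t ht] using hpos t ht
  have hlogE : AbsolutelyContinuousOnInterval (fun t => Real.log (D t)) 0 s :=
    absolutelyContinuous_log hs (absolutelyContinuous_primitive he _) fun t ht => by
      simpa only [hD, ← hE t ht] using hEpos t ht
  have hdL : ∀ᵐ t, t ∈ Icc 0 s → HasDerivAt (fun t => Real.log (G t)) (l t / L t) t := by
    filter_upwards [ae_hasDerivAt_primitive hs hl (L 0)] with t ht hts
    rw [hL t hts]
    refine (ht hts).log ?_
    rw [← hL t hts]
    exact (hpos t hts).ne'
  have hdE : ∀ᵐ t, t ∈ Icc 0 s → HasDerivAt (fun t => Real.log (D t)) (e t / E t) t := by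
    filter_upwards [ae_hasDerivAt_primitive hs he (E 0)] with t ht hts
    rw [hE t hts]
    refine (ht hts).log ?_
    rw [← hE t hts]
    exact (hEpos t hts).ne'
  -- Gronwall for the quotient: log E - log L has derivative e/E - l/L ≤ k almost everywhere.
  have hQ : ∀ t ∈ Icc 0 s, E t ≤ L t * (Real.exp K * (E 0 / L 0)) := by
    intro t ht
    have hIcc : ∀ r ∈ Icc 0 t, r ∈ Icc 0 s := fun r hr => ⟨hr.1, hr.2.trans ht.2⟩
    have hmono : uIcc 0 t ⊆ uIcc 0 s := by
      rw [uIcc_of_le ht.1, uIcc_of_le hs]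
      exact hIcc
    have h := sub_le_integral_of_deriv_le ht.1 ((hlogE.mono hmono).fun_sub (hlogL.mono hmono))
      (f' := fun t => e t / E t - l t / L t) (g := k) (by
        filter_upwards [hdE, hdL] with r h3 h4 hr
        exact (h3 (hIcc r hr)).sub (h4 (hIcc r hr))) (hsub hk t ht) (by
        have h5 := ae_restrict_of_ae_restrict_of_subset (Ioc_subset_Ioc_right ht.2) h1
        rw [ae_restrict_iff' measurableSet_Ioc] at h5 ⊢
        filter_upwards [h5] with r h6 hr
        have hr' := hIcc r ⟨hr.1.le, hr.2⟩
        have hLr := hpos r hr'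
        have hEr := hEpos r hr'
        rw [div_sub_div _ _ hEr.ne' hLr.ne', div_le_iff₀ (mul_pos hEr hLr)]
        linarith [h6 hr])
    simp only [hG, hD] at h
    rw [← hE t ht, ← hL t ht, ← hE 0 hs0, ← hL 0 hs0, ← Real.log_div (hEpos t ht).ne'
      (hpos t ht).ne', ← Real.log_div (hEpos 0 hs0).ne' (hpos 0 hs0).ne'] at h
    have h7 : Real.log (E t / L t) ≤ K + Real.log (E 0 / L 0) := by linarith [hK t ht]
    rw [Real.log_le_iff_le_exp (div_pos (hEpos t ht) (hpos t ht)), Real.exp_add,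
      Real.exp_log (div_pos (hEpos 0 hs0) (hpos 0 hs0)), div_le_iff₀ (hpos t ht)] at h7
    linarith
  set q := Real.exp K * (E 0 / L 0) with hq
  have hq0 : 0 ≤ q := mul_nonneg (Real.exp_pos _).le (div_pos (hEpos 0 hs0) (hpos 0 hs0)).le
  have hcki : IntervalIntegrable (fun t => (c + k t) * q) volume 0 s :=
    (intervalIntegrable_const.add hk).mul_const q
  -- With the quotient bounded by q, -log L grows at rate at most (c + k) q.
  have h := sub_le_integral_of_deriv_le hs hlogL.fun_neg (f' := fun t => -(l t / L t))
    (g := fun t => (c + k t) * q) (by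
      filter_upwards [hdL] with t ht hts
      exact (ht hts).neg) hcki (by
      rw [ae_restrict_iff' measurableSet_Ioc] at h2 ⊢
      filter_upwards [h2] with t h6 ht
      have ht' : t ∈ Icc 0 s := ⟨ht.1.le, ht.2⟩
      have hLt := hpos t ht'
      rw [← neg_div, div_le_iff₀ hLt]
      calc -l t ≤ (c + k t) * E t := h6 ht
        _ ≤ (c + k t) * (L t * q) :=
          mul_le_mul_of_nonneg_left (hQ t ht') (add_nonneg hc (hk0 t))
        _ = _ := by ring)
  have h8 : ∫ t in (0 : ℝ)..s, (c + k t) * q ≤ (c * s + K) * q := by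
    rw [intervalIntegral.integral_mul_const, intervalIntegral.integral_add intervalIntegrable_const
      hk, intervalIntegral.integral_const, sub_zero, smul_eq_mul, mul_comm s]
    exact mul_le_mul_of_nonneg_right (by linarith [hK s hss]) hq0
  simp only [hG] at h
  rw [← hL s hss, ← hL 0 hs0] at h
  have h9 : Real.log (L 0) ≤ Real.log (L s) + (c * s + K) * q := by linarith
  rwa [Real.log_le_iff_le_exp (hpos 0 hs0), Real.exp_add, Real.exp_log (hpos s hss)] at h9

/-- L cannot vanish. Before a first zero s the lower bound holds with a constant uniform on [0, T],
and by continuity it persists at s, contradicting L 0 > 0. This is backward uniqueness. -/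
theorem dirichlet_quotient {L E l e k : ℝ → ℝ} {T c K : ℝ} (hT : 0 ≤ T) (hc : 0 ≤ c)
    (hl : IntervalIntegrable l volume 0 T) (he : IntervalIntegrable e volume 0 T)
    (hk : IntervalIntegrable k volume 0 T)
    (hL : ∀ t ∈ Icc 0 T, L t = L 0 + ∫ r in (0 : ℝ)..t, l r)
    (hE : ∀ t ∈ Icc 0 T, E t = E 0 + ∫ r in (0 : ℝ)..t, e r)
    (hL0 : 0 < L 0) (hLn : ∀ t ∈ Icc 0 T, 0 ≤ L t)
    (hLE : ∀ t ∈ Icc 0 T, L t ≤ E t) (hk0 : ∀ t, 0 ≤ k t)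
    (hK : ∫ r in (0 : ℝ)..T, k r ≤ K)
    (h1 : ∀ᵐ t ∂(volume.restrict (Ioc 0 T)), e t * L t - E t * l t ≤ k t * E t * L t)
    (h2 : ∀ᵐ t ∂(volume.restrict (Ioc 0 T)), -l t ≤ (c + k t) * E t) :
    ∀ t ∈ Icc 0 T, L 0 ≤ L t * Real.exp ((c * T + K) * (Real.exp K * (E 0 / L 0))) := by
  have hT0 : (0 : ℝ) ∈ Icc 0 T := left_mem_Icc.mpr hT
  have hE0 : 0 ≤ E 0 / L 0 := div_nonneg ((hLn 0 hT0).trans (hLE 0 hT0)) hL0.le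
  have key : ∀ s ∈ Icc 0 T, (∀ t ∈ Icc 0 s, 0 < L t) →
      L 0 ≤ L s * Real.exp ((c * T + K) * (Real.exp K * (E 0 / L 0))) := by
    intro s hs hpos
    have hIcc : ∀ t ∈ Icc 0 s, t ∈ Icc 0 T := fun t ht => ⟨ht.1, ht.2.trans hs.2⟩
    have hsub : uIcc 0 s ⊆ uIcc 0 T := by
      rw [uIcc_of_le hs.1, uIcc_of_le hT]
      exact hIcc
    have hss : Ioc 0 s ⊆ Ioc 0 T := Ioc_subset_Ioc_right hs.2
    refine (dirichlet_quotient_of_pos hs.1 hc (hl.mono_set hsub) (he.mono_set hsub)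
      (hk.mono_set hsub) (fun t ht => hL t (hIcc t ht)) (fun t ht => hE t (hIcc t ht)) hpos
      (fun t ht => hLE t (hIcc t ht)) hk0 (K := K) (fun t ht => ?_)
      (ae_restrict_of_ae_restrict_of_subset hss h1)
      (ae_restrict_of_ae_restrict_of_subset hss h2)).trans ?_
    · refine le_trans ?_ hK
      exact intervalIntegral.integral_mono_interval le_rfl ht.1 (ht.2.trans hs.2)
        (ae_of_all _ hk0) hk
    · refine mul_le_mul_of_nonneg_left (Real.exp_le_exp.mpr ?_) (hLn s hs)
      refine mul_le_mul_of_nonneg_right ?_ (mul_nonneg (Real.exp_pos _).le hE0)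
      have := mul_le_mul_of_nonneg_left hs.2 hc
      linarith
  have hcont : ContinuousOn L (Icc 0 T) := by
    have := (absolutelyContinuous_primitive hl (L 0)).continuousOn
    rw [uIcc_of_le hT] at this
    exact this.congr hL
  have hposT : ∀ t ∈ Icc 0 T, 0 < L t := by
    by_contra! hne
    obtain ⟨t₁, ht₁, hLt₁⟩ := hne
    have hzc : IsCompact (Icc 0 T ∩ L ⁻¹' Iic 0) :=
      isCompact_Icc.of_isClosed_subset (hcont.preimage_isClosed_of_isClosed isClosed_Icc
        isClosed_Iic) inter_subset_left
    obtain ⟨s, ⟨hs, hLs⟩, hmin⟩ := hzc.exists_isLeast ⟨t₁, ht₁, hLt₁⟩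
    have hbefore : ∀ t ∈ Icc 0 T, t < s → 0 < L t := by
      intro t ht hts
      by_contra hn
      exact absurd (hmin ⟨ht, not_lt.mp hn⟩) (not_le.mpr hts)
    have hs0 : 0 < s := by
      rcases hs.1.eq_or_lt with h | h
      · rw [← h] at hLs
        exact absurd hLs (not_le.mpr hL0)
      · exact h
    have hlow : ∀ t ∈ Ico 0 s,
        L 0 ≤ L t * Real.exp ((c * T + K) * (Real.exp K * (E 0 / L 0))) := fun t ht =>
      key t ⟨ht.1, ht.2.le.trans hs.2⟩ fun r hr =>
        hbefore r ⟨hr.1, hr.2.trans (ht.2.le.trans hs.2)⟩ (hr.2.trans_lt ht.2)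
    have hcs : ContinuousWithinAt L (Ico 0 s) s :=
      (hcont s hs).mono fun r hr => ⟨hr.1, hr.2.le.trans hs.2⟩
    have hne : (𝓝[Ico 0 s] s).NeBot := by
      rw [← mem_closure_iff_nhdsWithin_neBot, closure_Ico hs0.ne]
      exact right_mem_Icc.mpr hs0.le
    have hlim : L 0 ≤ L s * Real.exp ((c * T + K) * (Real.exp K * (E 0 / L 0))) :=
      ge_of_tendsto (hcs.tendsto.mul_const _)
        (eventually_nhdsWithin_of_forall hlow)
    have hle : L s * Real.exp ((c * T + K) * (Real.exp K * (E 0 / L 0))) ≤ 0 :=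
      mul_nonpos_of_nonpos_of_nonneg hLs (Real.exp_pos _).le
    linarith
  exact fun t ht => key t ht fun r hr => hposT r ⟨hr.1, hr.2.trans ht.2⟩

/-! ### A priori estimates -/

/-- Young's inequality. It absorbs the forcing into half of the dissipation 2ν‖A u‖², and with ν = 1
it handles the term ⟨w, n⟩. -/
theorem inner_forcing_le {E : Type*} [NormedAddCommGroup E] [InnerProductSpace ℝ E] {ν : ℝ}
    (hν : 0 < ν) (a f : E) : 2 * inner ℝ a f ≤ ν * ‖a‖ ^ 2 + ‖f‖ ^ 2 / ν := by
  have h1 := real_inner_le_norm a f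
  have h2 : ν * ‖a‖ ^ 2 + ‖f‖ ^ 2 / ν - 2 * (‖a‖ * ‖f‖) = (ν * ‖a‖ - ‖f‖) ^ 2 / ν := by
    field_simp
    ring
  have h3 : 0 ≤ (ν * ‖a‖ - ‖f‖) ^ 2 / ν := by positivity
  linarith

/-- The enstrophy estimate. -/
theorem IsStrongSolution.enstrophy_le {ν T : ℝ} {f : L2Field} {u : ℝ → L2Field} (hν : 0 < ν)
    (hT : 0 ≤ T) (hu : IsStrongSolution ν T f u) {t : ℝ} (ht : t ∈ Icc 0 T) :
    vNorm (u t) ^ 2 + ν * ∫ s in (0 : ℝ)..t, ‖stokes (u s)‖ ^ 2 ≤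
      vNorm (u 0) ^ 2 + T * (‖f‖ ^ 2 / ν) := by
  obtain ⟨u', hu', -, hprim, heq⟩ := hu.evolution
  have hcoef : ∀ᵐ t ∂(volume.restrict (Ioc 0 T)),
      ∀ i k, coef i k (stokes (u t)) = freq k * coef i k (u t) := by
    filter_upwards [hu.mem_stokesDomain] with t ht i k
    exact coef_stokes ht i k
  obtain ⟨hi, hE⟩ := energy_identity (E := fun t => vNorm (u t) ^ 2) hT hu' hu.memLp_stokes hprim
    hcoef fun t ht => hasSum_vNorm (hu.mem_V t ht)
  have hsub : uIcc 0 t ⊆ uIcc 0 T := by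
    rw [uIcc_of_le ht.1, uIcc_of_le hT]
    exact Icc_subset_Icc_right ht.2
  have hA : IntervalIntegrable (fun s => ‖stokes (u s)‖ ^ 2) volume 0 t :=
    ((intervalIntegrable_iff_integrableOn_Ioc_of_le hT).mpr
      (hu.memLp_stokes.integrable_norm_pow (by simp))).mono_set hsub
  have hle : ∫ s in (0 : ℝ)..t, 2 * inner ℝ (stokes (u s)) (u' s) ≤
      ∫ s in (0 : ℝ)..t, (‖f‖ ^ 2 / ν - ν * ‖stokes (u s)‖ ^ 2) := by
    refine intervalIntegral.integral_mono_ae_restrict ht.1 (hi.mono_set hsub)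
      (intervalIntegrable_const.sub (hA.const_mul ν)) ?_
    rw [← restrict_Ioc_eq_restrict_Icc]
    refine ae_restrict_of_ae_restrict_of_subset (Ioc_subset_Ioc_right ht.2) ?_
    filter_upwards [heq, hu.mem_stokesDomain] with s ⟨b, hb, hbe⟩ hs
    have h1 : u' s = f - ν • stokes (u s) - leray b := by
      rw [← hbe]
      abel
    -- P is self-adjoint and fixes A u, so the orthogonality of (u·∇)u to A u survives the
    -- projection.
    have h2 : inner ℝ (stokes (u s)) (leray b) = 0 := by
      rw [real_inner_comm, inner_leray_of_mem (stokes_mem_H hs), inner_convection_stokes hs hb]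
    have h3 := inner_forcing_le hν (stokes (u s)) f
    rw [h1, inner_sub_right, inner_sub_right, h2, inner_smul_right, real_inner_self_eq_norm_sq]
    linarith
  rw [intervalIntegral.integral_sub intervalIntegrable_const (hA.const_mul ν),
    intervalIntegral.integral_const, intervalIntegral.integral_const_mul ν, sub_zero,
    smul_eq_mul] at hle
  have h4 := hE t ht
  have h5 : t * (‖f‖ ^ 2 / ν) ≤ T * (‖f‖ ^ 2 / ν) :=
    mul_le_mul_of_nonneg_right ht.2 (by positivity)
  linarith

theorem IsStrongSolution.vNorm_sq_le {ν T : ℝ} {f : L2Field} {u : ℝ → L2Field} (hν : 0 < ν)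
    (hT : 0 ≤ T) (hu : IsStrongSolution ν T f u) {t : ℝ} (ht : t ∈ Icc 0 T) :
    vNorm (u t) ^ 2 ≤ vNorm (u 0) ^ 2 + T * (‖f‖ ^ 2 / ν) := by
  have h1 := hu.enstrophy_le hν hT ht
  have h2 : 0 ≤ ν * ∫ s in (0 : ℝ)..t, ‖stokes (u s)‖ ^ 2 :=
    mul_nonneg hν.le (intervalIntegral.integral_nonneg ht.1 fun s _ => sq_nonneg _)
  linarith

theorem IsStrongSolution.integral_stokes_le {ν T : ℝ} {f : L2Field} {u : ℝ → L2Field}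
    (hν : 0 < ν) (hT : 0 ≤ T) (hu : IsStrongSolution ν T f u) :
    ∫ s in (0 : ℝ)..T, ‖stokes (u s)‖ ^ 2 ≤ (vNorm (u 0) ^ 2 + T * (‖f‖ ^ 2 / ν)) / ν := by
  rw [le_div_iff₀ hν]
  have h1 := hu.enstrophy_le hν hT (right_mem_Icc.mpr hT)
  have h2 := sq_nonneg (vNorm (u T))
  linarith

/-! ### The difference of two solutions -/

/-- The differential inequality for the Dirichlet quotient, for a linear equation
`w' = -ν A w - n`. -/
theorem dirichlet_quotient_deriv_le {E : Type*} [NormedAddCommGroup E] [InnerProductSpace ℝ E]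
    {ν : ℝ} (hν : 0 < ν) (a w n : E) :
    2 * inner ℝ a (-(ν • a) - n) * ‖w‖ ^ 2 - inner ℝ w a * (2 * inner ℝ w (-(ν • a) - n)) ≤
      1 / (2 * ν) * ‖n‖ ^ 2 * ‖w‖ ^ 2 := by
  by_cases hw : w = 0
  · simp [hw]
  have hL : 0 < ‖w‖ ^ 2 := by positivity
  -- Here z = ‖w‖² (a - λ w) with λ = ⟨w, a⟩ / ‖w‖². It is orthogonal to w, whence ‖z‖² = ‖w‖² ⟨z,
  -- a⟩.
  set z := ‖w‖ ^ 2 • a - inner ℝ w a • w with hz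
  have hzn : ∀ y, inner ℝ z y = ‖w‖ ^ 2 * inner ℝ a y - inner ℝ w a * inner ℝ w y := by
    intro y
    rw [hz, inner_sub_left, real_inner_smul_left, real_inner_smul_left]
  have hzz : ‖z‖ ^ 2 = ‖w‖ ^ 2 * inner ℝ z a := by
    rw [← real_inner_self_eq_norm_sq z]
    conv_lhs => rw [hzn z, real_inner_comm z a, real_inner_comm z w, hzn a, hzn w]
    rw [hzn a, real_inner_self_eq_norm_sq w, real_inner_comm w a]
    ring
  have h1 : 2 * inner ℝ a (-(ν • a) - n) * ‖w‖ ^ 2 - inner ℝ w a * (2 * inner ℝ w (-(ν • a) - n)) =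
      -(2 * ν) * inner ℝ z a - 2 * inner ℝ z n := by
    rw [hzn, hzn]
    simp only [inner_sub_right, inner_neg_right, inner_smul_right]
    ring
  rw [h1]
  have h2 : -(‖z‖ * ‖n‖) ≤ inner ℝ z n := (abs_le.mp (abs_real_inner_le_norm z n)).1
  have h3 : inner ℝ z a = ‖z‖ ^ 2 / ‖w‖ ^ 2 := by rw [hzz]; field_simp
  rw [h3]
  -- Completing the square in ‖z‖.
  have h4 : 1 / (2 * ν) * ‖n‖ ^ 2 * ‖w‖ ^ 2 -
      (-(2 * ν) * (‖z‖ ^ 2 / ‖w‖ ^ 2) + 2 * (‖z‖ * ‖n‖)) =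
      (2 * ν * ‖z‖ - ‖n‖ * ‖w‖ ^ 2) ^ 2 / (2 * ν * ‖w‖ ^ 2) := by
    field_simp
    ring
  have h5 : 0 ≤ (2 * ν * ‖z‖ - ‖n‖ * ‖w‖ ^ 2) ^ 2 / (2 * ν * ‖w‖ ^ 2) := by positivity
  linarith

/-- A bound for the time integral of `(1 + 1/(2ν)) 32 S (‖A u‖² + ‖A v‖²)`, where `S` is the Sobolev
constant and `R` bounds the initial enstrophies plus the contribution of the forcing. -/
def growthBound (ν R : ℝ) : ℝ := (1 + 1 / (2 * ν)) * (32 * sobolevConst) * (2 * (R / ν))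

theorem growthBound_nonneg {ν R : ℝ} (hν : 0 < ν) (hR : 0 ≤ R) : 0 ≤ growthBound ν R := by
  have := sobolevConst_nonneg
  unfold growthBound
  positivity

theorem norm_sq_sub_le_of_isStrongSolution {ν T R : ℝ} {f : L2Field} {u v : ℝ → L2Field}
    (hν : 0 < ν) (hT : 0 ≤ T) (hu : IsStrongSolution ν T f u) (hv : IsStrongSolution ν T f v)
    (hRu : vNorm (u 0) ^ 2 + T * (‖f‖ ^ 2 / ν) ≤ R)
    (hRv : vNorm (v 0) ^ 2 + T * (‖f‖ ^ 2 / ν) ≤ R) (h0 : u 0 ≠ v 0) :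
    ∀ t ∈ Icc 0 T, ‖u 0 - v 0‖ ^ 2 ≤ ‖u t - v t‖ ^ 2 *
      Real.exp (((2 * ν + 1) * T + growthBound ν R) *
        (Real.exp (growthBound ν R) * (vNorm (u 0 - v 0) ^ 2 / ‖u 0 - v 0‖ ^ 2))) := by
  obtain ⟨u', hu', -, hup, hue⟩ := hu.evolution
  obtain ⟨v', hv', -, hvp, hve⟩ := hv.evolution
  have hS := sobolevConst_nonneg
  have hT0 : (0 : ℝ) ∈ Icc 0 T := left_mem_Icc.mpr hT
  have hui : IntervalIntegrable u' volume 0 T :=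
    (intervalIntegrable_iff_integrableOn_Ioc_of_le hT).mpr (hu'.integrable (by simp))
  have hvi : IntervalIntegrable v' volume 0 T :=
    (intervalIntegrable_iff_integrableOn_Ioc_of_le hT).mpr (hv'.integrable (by simp))
  have hsub : ∀ t ∈ Icc 0 T, uIcc 0 t ⊆ uIcc 0 T := by
    intro t ht
    rw [uIcc_of_le ht.1, uIcc_of_le hT]
    exact Icc_subset_Icc_right ht.2
  have hV : ∀ t ∈ Icc 0 T, u t - v t ∈ V := fun t ht => sub_mem_V (hu.mem_V t ht) (hv.mem_V t ht)
  have hw' := hu'.sub hv'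
  have hg := hu.memLp_stokes.sub hv.memLp_stokes
  have hprim : ∀ t ∈ Icc 0 T, u t - v t = u 0 - v 0 + ∫ s in (0 : ℝ)..t, (u' - v') s := by
    intro t ht
    rw [hup t ht, hvp t ht]
    simp only [Pi.sub_apply]
    rw [intervalIntegral.integral_sub (hui.mono_set (hsub t ht)) (hvi.mono_set (hsub t ht))]
    abel
  have hcont : ContinuousOn (fun t => u t - v t) (Icc 0 T) := by
    have h1 := intervalIntegral.continuousOn_primitive_interval'
      (hui.sub hvi) (left_mem_uIcc (a := (0 : ℝ)) (b := T))
    rw [uIcc_of_le hT] at h1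
    exact (continuousOn_const.add h1).congr hprim
  have hwL : MemLp (fun t => u t - v t) 2 (volume.restrict (Ioc 0 T)) := by
    obtain ⟨C, hC⟩ := isCompact_Icc.exists_bound_of_continuousOn hcont
    refine MemLp.of_bound ((hcont.mono Ioc_subset_Icc_self).aestronglyMeasurable
      measurableSet_Ioc) C ?_
    rw [ae_restrict_iff' measurableSet_Ioc]
    exact ae_of_all _ fun t ht => hC t (Ioc_subset_Icc_self ht)
  obtain ⟨hl, hL⟩ := energy_identity (w := fun t => u t - v t) (m := fun _ => 1)
    (E := fun t => ‖u t - v t‖ ^ 2) hT hw' hwL hprim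
    (ae_of_all _ fun t i k => by simp) fun t ht => by simpa using hasSum_modeEnergy (u t - v t)
  -- A u - A v takes the place of A w: only the multiplier relation with w is needed.
  have hcoef : ∀ᵐ t ∂(volume.restrict (Ioc 0 T)), ∀ i k,
      coef i k (((fun t => stokes (u t)) - fun t => stokes (v t)) t) =
        freq k * coef i k (u t - v t) := by
    filter_upwards [hu.mem_stokesDomain, hv.mem_stokesDomain] with t h1 h2 i k
    rw [Pi.sub_apply, map_sub, map_sub, coef_stokes h1, coef_stokes h2]
    ring
  obtain ⟨he, hE⟩ := energy_identity (w := fun t => u t - v t) (m := freq)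
    (E := fun t => vNorm (u t - v t) ^ 2) hT hw' hg hprim hcoef
    fun t ht => hasSum_vNorm (hV t ht)
  have hm0 : ∀ t, 0 ≤ 32 * sobolevConst * (‖stokes (u t)‖ ^ 2 + ‖stokes (v t)‖ ^ 2) :=
    fun t => by positivity
  have hAu : IntervalIntegrable (fun s => ‖stokes (u s)‖ ^ 2) volume 0 T :=
    (intervalIntegrable_iff_integrableOn_Ioc_of_le hT).mpr
      (hu.memLp_stokes.integrable_norm_pow (by simp))
  have hAv : IntervalIntegrable (fun s => ‖stokes (v s)‖ ^ 2) volume 0 T :=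
    (intervalIntegrable_iff_integrableOn_Ioc_of_le hT).mpr
      (hv.memLp_stokes.integrable_norm_pow (by simp))
  have hstruct : ∀ᵐ t ∂(volume.restrict (Ioc 0 T)), ∃ n : L2Field,
      (u' - v') t = -(ν • (stokes (u t) - stokes (v t))) - n ∧
      ‖n‖ ^ 2 ≤ 32 * sobolevConst * (‖stokes (u t)‖ ^ 2 + ‖stokes (v t)‖ ^ 2) *
        vNorm (u t - v t) ^ 2 ∧
      inner ℝ (u t - v t) (stokes (u t) - stokes (v t)) = vNorm (u t - v t) ^ 2 := by
    filter_upwards [hue, hve, hu.mem_stokesDomain, hv.mem_stokesDomain, hcoef] with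
      t ⟨b, hb, hbe⟩ ⟨b', hb', hbe'⟩ h1 h2 h3
    refine ⟨leray b - leray b', ?_, ?_, ?_⟩
    · have e1 : u' t = f - ν • stokes (u t) - leray b := by rw [← hbe]; abel
      have e2 : v' t = f - ν • stokes (v t) - leray b' := by rw [← hbe']; abel
      rw [Pi.sub_apply, e1, e2, smul_sub]
      abel
    · rw [← map_sub]
      have h4 := (norm_leray_le (b - b')).trans (norm_convection_sub_le h1 h2 hb hb')
      refine (pow_le_pow_left₀ (norm_nonneg _) h4 2).trans ?_
      rw [mul_pow, mul_pow, mul_pow, Real.sq_sqrt hS]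
      refine mul_le_mul_of_nonneg_right ?_ (sq_nonneg _)
      have h5 : (‖stokes (u t)‖ + ‖stokes (v t)‖) ^ 2 ≤
          2 * (‖stokes (u t)‖ ^ 2 + ‖stokes (v t)‖ ^ 2) := by
        nlinarith [sq_nonneg (‖stokes (u t)‖ - ‖stokes (v t)‖)]
      calc _ ≤ 4 ^ 2 * sobolevConst * (2 * (‖stokes (u t)‖ ^ 2 + ‖stokes (v t)‖ ^ 2)) := by
            gcongr
        _ = _ := by ring
    · refine (hasSum_inner_coef _ _).unique
        ((hasSum_vNorm (sub_mem_V h1.2 h2.2)).congr_fun fun k => ?_)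
      rw [modeEnergy, Finset.mul_sum]
      refine Finset.sum_congr rfl fun i _ => ?_
      have h4 := h3 i k
      rw [Pi.sub_apply] at h4
      rw [h4, mul_left_comm, ← Complex.normSq_eq_conj_mul_self, ← Complex.ofReal_mul,
        Complex.ofReal_re, Complex.normSq_eq_norm_sq]
  -- One k serves both inequalities: the quotient estimate costs the factor 1/(2ν) and the estimate
  -- of -l the factor 1. There 2νE + ‖w‖² + ‖n‖², with ‖w‖² ≤ E, gives c = 2ν + 1.
  refine dirichlet_quotient (L := fun t => ‖u t - v t‖ ^ 2) (E := fun t => vNorm (u t - v t) ^ 2)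
    (k := fun t => (1 + 1 / (2 * ν)) *
      (32 * sobolevConst * (‖stokes (u t)‖ ^ 2 + ‖stokes (v t)‖ ^ 2)))
    hT (by positivity) hl he (((hAu.add hAv).const_mul _).const_mul _) hL hE ?_
    (fun t _ => sq_nonneg _) ?_ (fun t => mul_nonneg (by positivity) (hm0 t)) ?_ ?_ ?_
  · have := norm_pos_iff.mpr (sub_ne_zero.mpr h0)
    positivity
  · intro t ht
    exact pow_le_pow_left₀ (norm_nonneg _) (norm_le_vNorm (hV t ht)) 2
  · rw [intervalIntegral.integral_const_mul, intervalIntegral.integral_const_mul,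
      intervalIntegral.integral_add hAu hAv]
    have h1 := hu.integral_stokes_le hν hT
    have h2 := hv.integral_stokes_le hν hT
    have h3 : ∀ {x : ℝ}, x ≤ R → x / ν ≤ R / ν := fun h => div_le_div_of_nonneg_right h hν.le
    have h4 : (∫ s in (0 : ℝ)..T, ‖stokes (u s)‖ ^ 2) + ∫ s in (0 : ℝ)..T, ‖stokes (v s)‖ ^ 2 ≤
        2 * (R / ν) := by linarith [h3 hRu, h3 hRv]
    refine (mul_le_mul_of_nonneg_left (mul_le_mul_of_nonneg_left h4
      (mul_nonneg (by norm_num) hS)) (by positivity)).trans_eq ?_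
    rw [growthBound]
    ring
  · filter_upwards [hstruct] with t ⟨n, h1, h2, h3⟩
    have h4 := dirichlet_quotient_deriv_le hν (stokes (u t) - stokes (v t)) (u t - v t) n
    rw [← h1, h3] at h4
    refine h4.trans (mul_le_mul_of_nonneg_right ?_ (sq_nonneg _))
    rw [mul_assoc (1 + 1 / (2 * ν))]
    refine mul_le_mul ?_ h2 (sq_nonneg _) (by positivity)
    linarith
  · filter_upwards [hstruct, ae_restrict_mem measurableSet_Ioc] with t ⟨n, h1, h2, h3⟩ ht
    rw [h1, inner_sub_right, inner_neg_right, inner_smul_right, h3]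
    have h4 := norm_le_vNorm (hV t (Ioc_subset_Icc_self ht))
    have h5 := pow_le_pow_left₀ (norm_nonneg _) h4 2
    have h6 := inner_forcing_le one_pos (u t - v t) n
    have h7 : 0 ≤ 1 / (2 * ν) *
        (32 * sobolevConst * (‖stokes (u t)‖ ^ 2 + ‖stokes (v t)‖ ^ 2)) *
          vNorm (u t - v t) ^ 2 := by positivity
    linarith

theorem vNorm_sub_sq_le {u v : L2Field} (hu : u ∈ V) (hv : v ∈ V) :
    vNorm (u - v) ^ 2 ≤ 2 * (vNorm u ^ 2 + vNorm v ^ 2) := by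
  rw [vNorm_sq, vNorm_sq, vNorm_sq, ← Finset.sum_add_distrib, Finset.mul_sum]
  refine Finset.sum_le_sum fun j _ => ?_
  rw [weakPartial_sub hu hv]
  have h := norm_sub_le (weakPartial j u) (weakPartial j v)
  have h2 := pow_le_pow_left₀ (norm_nonneg _) h 2
  nlinarith [sq_nonneg (‖weakPartial j u‖ - ‖weakPartial j v‖)]

end PeriodicNS

end

/-! ### Choice of the constants and proof of both estimates -/

theorem theorem2p2 (U ν T F : ℝ) (hν : 0 < ν) (hT : 0 < T) :
    ∃ c₁ c₂ : ℝ, ∀ f ∈ PeriodicNS.V, ‖f‖ = F →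
      ∀ u v : ℝ → PeriodicNS.L2Field,
        PeriodicNS.IsStrongSolution ν T f u → PeriodicNS.IsStrongSolution ν T f v →
        PeriodicNS.vNorm (u 0) + PeriodicNS.vNorm (v 0) ≤ U →
          ((∃ M < c₁, ∀ t ∈ Set.Icc 0 T, ‖u t - v t‖ ≤ M) ∧
            ∀ t ∈ Set.Icc 0 T,
              (u t = v t → u 0 = v 0) ∧
              (u t ≠ v t → ‖u 0 - v 0‖ ≤ c₁ * (Real.log (c₁ / ‖u t - v t‖)) ^ (-1 / 2 : ℝ))) ∧
          (∀ cP : ℝ, 0 < cP →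
            PeriodicNS.vNorm (u 0 - v 0) ^ 2 / ‖u 0 - v 0‖ ^ 2 ≤ cP →
              ∀ t ∈ Set.Icc 0 T, ‖u 0 - v 0‖ ≤ Real.exp (c₂ * cP) * ‖u t - v t‖) := by
  have hν0 := hν.le
  have hT0 : (0 : ℝ) ∈ Set.Icc 0 T := Set.left_mem_Icc.mpr hT.le
  set R : ℝ := U ^ 2 + T * (F ^ 2 / ν) with hR
  have hRnn : 0 ≤ R := by positivity
  set K := PeriodicNS.growthBound ν R with hK
  have hKnn : 0 ≤ K := PeriodicNS.growthBound_nonneg hν hRnn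
  set G : ℝ := ((2 * ν + 1) * T + K) * Real.exp K with hG
  have hGnn : 0 ≤ G := by positivity
  set M : ℝ := 2 * √R with hM
  have hMnn : 0 ≤ M := by positivity
  -- Chosen so that c₁ > M, c₁ ≥ 1 and therefore c₁² ≥ c₁ M + 2GU², which is the final inequality in
  -- A.
  set c₁ : ℝ := M + 2 * (G * U ^ 2) + 1 with hc₁
  have hGU : 0 ≤ G * U ^ 2 := by positivity
  refine ⟨c₁, G / 2, fun f _ hF u v hu hv hU => ?_⟩
  have hu0 := PeriodicNS.vNorm_nonneg (u 0)
  have hv0 := PeriodicNS.vNorm_nonneg (v 0)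
  have hu2 : PeriodicNS.vNorm (u 0) ^ 2 ≤ U ^ 2 := pow_le_pow_left₀ hu0 (by linarith) 2
  have hv2 : PeriodicNS.vNorm (v 0) ^ 2 ≤ U ^ 2 := pow_le_pow_left₀ hv0 (by linarith) 2
  have hRu : PeriodicNS.vNorm (u 0) ^ 2 + T * (‖f‖ ^ 2 / ν) ≤ R := by rw [hF, hR]; linarith
  have hRv : PeriodicNS.vNorm (v 0) ^ 2 + T * (‖f‖ ^ 2 / ν) ≤ R := by rw [hF, hR]; linarith
  -- If u 0 = v 0 this is 0 by the convention for division by zero, so the hypothesis of B then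
  -- holds automatically, as intended.
  set q := PeriodicNS.vNorm (u 0 - v 0) ^ 2 / ‖u 0 - v 0‖ ^ 2 with hq
  have hsup : ∀ t ∈ Set.Icc 0 T, ‖u t - v t‖ ≤ M := by
    intro t ht
    have h1 := (PeriodicNS.norm_le_vNorm (hu.mem_V t ht)).trans
      (Real.le_sqrt_of_sq_le ((hu.vNorm_sq_le hν hT.le ht).trans hRu))
    have h2 := (PeriodicNS.norm_le_vNorm (hv.mem_V t ht)).trans
      (Real.le_sqrt_of_sq_le ((hv.vNorm_sq_le hν hT.le ht).trans hRv))
    linarith [norm_sub_le (u t) (v t)]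
  have hback : u 0 ≠ v 0 → ∀ t ∈ Set.Icc 0 T,
      ‖u 0 - v 0‖ ≤ Real.exp (G / 2 * q) * ‖u t - v t‖ := by
    intro h0 t ht
    have h1 := PeriodicNS.norm_sq_sub_le_of_isStrongSolution hν hT.le hu hv hRu hRv h0 t ht
    refine abs_le_of_sq_le_sq' ?_ (by positivity) |>.2
    refine h1.trans_eq ?_
    rw [mul_pow, ← Real.exp_nat_mul, mul_comm]
    congr 2
    rw [hG]
    push_cast
    ring
  refine ⟨⟨⟨M, by linarith, hsup⟩, fun t ht => ⟨fun huv => ?_, fun huv => ?_⟩⟩,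
    fun cP _ hq' t ht => ?_⟩
  · by_contra h0
    have h1 := hback h0 t ht
    rw [huv, sub_self, norm_zero, mul_zero] at h1
    exact h0 (sub_eq_zero.mp (norm_le_zero_iff.mp h1))
  · have hwt : 0 < ‖u t - v t‖ := norm_pos_iff.mpr (sub_ne_zero.mpr huv)
    have hlog : 0 < Real.log (c₁ / ‖u t - v t‖) := by
      refine Real.log_pos ?_
      rw [one_lt_div hwt]
      linarith [hsup t ht]
    rw [neg_div, Real.rpow_neg hlog.le, ← Real.sqrt_eq_rpow, ← div_eq_mul_inv,
      le_div_iff₀ (Real.sqrt_pos.mpr hlog)]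
    by_cases h0 : u 0 = v 0
    · rw [h0, sub_self, norm_zero, zero_mul]
      positivity
    have hw0 : 0 < ‖u 0 - v 0‖ := norm_pos_iff.mpr (sub_ne_zero.mpr h0)
    refine abs_le_of_sq_le_sq' ?_ (by positivity) |>.2
    rw [mul_pow, Real.sq_sqrt hlog.le]
    have hc₁pos : 0 < c₁ := by linarith
    -- The logarithm of the backward bound, with log x ≤ x for x = c₁/‖w(0)‖. This crude bound
    -- suffices, since multiplication by ‖w(0)‖² turns it into c₁ ‖w(0)‖ ≤ c₁ M.
    have h1 : Real.log (c₁ / ‖u t - v t‖) ≤ c₁ / ‖u 0 - v 0‖ + G / 2 * q := by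
      rw [Real.log_le_iff_le_exp (div_pos hc₁pos hwt), Real.exp_add, div_le_iff₀ hwt]
      have h2 : c₁ / ‖u 0 - v 0‖ ≤ Real.exp (c₁ / ‖u 0 - v 0‖) := by
        linarith [Real.add_one_le_exp (c₁ / ‖u 0 - v 0‖)]
      calc c₁ = c₁ / ‖u 0 - v 0‖ * ‖u 0 - v 0‖ := by field_simp
        _ ≤ Real.exp (c₁ / ‖u 0 - v 0‖) * (Real.exp (G / 2 * q) * ‖u t - v t‖) :=
          mul_le_mul h2 (hback h0 t ht) hw0.le (Real.exp_pos _).le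
        _ = _ := by ring
    have hqU : ‖u 0 - v 0‖ ^ 2 * q ≤ 4 * U ^ 2 := by
      rw [hq, mul_div_cancel₀ _ (by positivity)]
      have := PeriodicNS.vNorm_sub_sq_le (hu.mem_V 0 hT0) (hv.mem_V 0 hT0)
      linarith
    calc ‖u 0 - v 0‖ ^ 2 * Real.log (c₁ / ‖u t - v t‖)
        ≤ ‖u 0 - v 0‖ ^ 2 * (c₁ / ‖u 0 - v 0‖ + G / 2 * q) := by gcongr
      _ = c₁ * ‖u 0 - v 0‖ + G / 2 * (‖u 0 - v 0‖ ^ 2 * q) := by field_simp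
      _ ≤ c₁ * M + G / 2 * (4 * U ^ 2) := by
        gcongr
        exact hsup 0 hT0
      _ ≤ c₁ ^ 2 := by
        nlinarith
  · by_cases h0 : u 0 = v 0
    · rw [h0, sub_self, norm_zero]
      positivity
    · refine (hback h0 t ht).trans ?_
      gcongr
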